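/- **Setting.** Let $\mathfrak g$ be a finite-dimensional simple real Lie algebra of compact type (negative definite Killing form), $\mathfrak t\subset\mathfrak g$ a Cartan subalgebra, $\mathfrak h=\mathfrak t_{\mathbb C}\subset\mathfrak g_{\mathbb C}$, with root system $R=R_+\sqcup(-R_+)$. Fix a Chevalley basis $H_1,\dots,H_l$ (a basis of $\mathfrak h$), $\tau_\alpha$ ($\alpha\in R$) of $\mathfrak g_{\mathbb C}$: $[H,\tau_\alpha]=\alpha(H)\tau_\alpha$ for $H\in\mathfrak h$, $[\tau_\alpha,\tau_{-\alpha}]=-H_\alpha$ with $\alpha(H_\alpha)=2$, $[\tau_\alpha,\tau_\beta]=N_{\alpha\beta}\tau_{\alpha+\beta}$ with $N_{\alpha\beta}\in\mathbb R$ if $\alpha+\beta\ne0$, and $\overline{\tau_\alpha}=\tau_{-\alpha}$ (conjugation with respect to $\mathfrak g$). Let $V$ be a complex vector space with a positive definite scalar product on which $\mathfrak g$ acts by skew-Hermitian operators $\tilde{\mathcal L}_x$; extend the action complex linearly to $\mathfrak g_{\mathbb C}$. Let $\chi\in\mathfrak h^*$ (extended by $0$ to the root vectors) be regular and dominant: $\langle\chi,H_\alpha\rangle$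 is real and $>0$ for all $\alpha>0$. Put $\mathcal L_x=\tilde{\mathcal L}_x-\langle\chi,x\rangle$, $2\varrho=\sum_{\alpha>0}\alpha$, $r_\alpha=r_{-\alpha}=\langle\chi+2\varrho,H_\alpha\rangle$ for $\alpha>0$, and $$V(\mathfrak g,\chi)=\{\varphi\in V:\ \mathcal L_{\tau_\alpha}\varphi=0\ (\alpha>0),\ \mathcal L_H\varphi=0\ (H\in\mathfrak h)\}.$$ On $\mathcal C=\bigwedge\mathfrak g_{\mathbb C}^*$ let $c^\alpha$ be multiplication by the form $\theta^{-\alpha}$ dual to $\tau_{-\alpha}$, $b_\alpha$ substitution of $\tau_\alpha$, $c^i$ multiplication by the form dual to $H_i$, and $b_i$ substitution of $H_i$. Let $\omega=\theta^{-\alpha_1}\wedge\dots\wedge\theta^{-\alpha_m}$ ($R_+=\{\alpha_1,\dots,\alpha_m\}$). Put $$L_\alpha=-\sum_{\beta\in R,\,\beta\ne-\alpha}N_{\alpha\beta}c^{-\beta}b_{\alpha+\beta}+c^\alpha\iota_{H_\alpha}+\sum_i\alpha(H_i)c^ib_\alpha,\qquad L_H=-\sum_{\beta>0}\beta(H)\big(c^{-\beta}b_\beta+b_{-\beta}c^\beta\big)\quad(H\in\mathfrak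 h),$$ where $\iota_{H_\alpha}$ is substitution of $H_\alpha$, $d=\frac12\sum_{\alpha>0}(c^{-\alpha}L_\alpha+L_{-\alpha}c^\alpha)+\frac12\sum_ic^iL_{H_i}$, $\overline{\rm gh}=\sum_{\alpha>0}c^{-\alpha}b_\alpha$, ${\rm gh}=\sum_{\alpha>0}b_{-\alpha}c^\alpha$, ${\rm gh}_{\rm rel}=\overline{\rm gh}-{\rm gh}$. On $\mathcal C(V)=\mathcal C\otimes V$ let $$D=\sum_{\alpha\in R}c^{-\alpha}\otimes\mathcal L_{\tau_\alpha}+\sum_ic^i\otimes\mathcal L_{H_i}+d\otimes1,\qquad L^{\rm tot}_H=1\otimes\mathcal L_H+L_H\otimes1,$$ $$\mathcal C_{\rm rel}(V)=\{\Psi:\ L_H^{\rm tot}\Psi=0\ (H\in\mathfrak h),\ b_i\Psi=0\ (1\le i\le l)\},\qquad \mathcal A_{\rm rel}=\ker D^2\cap\mathcal C_{\rm rel}(V).$$ $D_{\rm rel}$ is the restriction of $D$. Let $\mathcal A^r_{\rm rel}\subset\mathcal A_{\rm rel}$ be the eigenspace of ${\rm gh}_{\rm rel}$ for $r\in\mathbb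 Z$, and let $$H^r_{\rm rel}=\ker\big(D_{\rm rel}|_{\mathcal A^r_{\rm rel}}\big)\big/D_{\rm rel}\big(\mathcal A^{r-1}_{\rm rel}\big).$$ Equip $\mathcal C_{\rm rel}(V)$ with the Kähler scalar product, the restriction of the following scalar product on $\{\Psi\in\mathcal C(V): b_i\Psi=0\ \forall i\}$: the monomials $b_{-\alpha_1}\cdots b_{-\alpha_k}c^{-\beta_1}\cdots c^{-\beta_s}\omega$, for different sets $\{\alpha_1,\dots,\alpha_k\},\{\beta_1,\dots,\beta_s\}\subset R_+$, are orthogonal with squared norm $\prod_ir_{\alpha_i}/\prod_jr_{\beta_j}$, and one takes the tensor product with the scalar product of $V$. Let $D_{\rm rel}^\dagger$ be the adjoint of $D_{\rm rel}$ on $\mathcal C_{\rm rel}(V)$, $\bigtriangleup=D_{\rm rel}D_{\rm rel}^\dagger+D_{\rm rel}^\dagger D_{\rm rel}$, $\mathfrak H(\bigtriangleup)=\ker\bigtriangleup|_{\mathcal A_{\rm rel}}$, and let $\mathfrak H^p_q(\bigtriangleup)$ be the subspace of $\mathfrak H(\bigtriangleup)$ on which $\overline{\rm gh}=p$ and ${\rm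 gh}=q$ (it has ghost number $p-q$). **Proposition 2.3 (Vanishing theorem).** 1. $H^r_{\rm rel}=0$ for every $r>0$. 2. The root component $\mathfrak H^0_0(\bigtriangleup)$ of the harmonic space at ghost number zero is isomorphic to $V(\mathfrak g,\chi)$, the isomorphism $V(\mathfrak g,\chi)\to\mathfrak H^0_0(\bigtriangleup)$ being $\varphi\mapsto\omega\otimes\varphi$. -/

import Mathlib

open TensorProduct

noncomputable section

namespace AnomalousLie

section LieAlgebraData

variable {𝔤 : Type*} [LieRing 𝔤] [LieAlgebra ℝ 𝔤]

variable (𝔤) in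
/-- The conjugation of the complexification `ℂ ⊗ 𝔤` with respect to the real form `𝔤`. -/
def conj : (ℂ ⊗[ℝ] 𝔤) →ₗ[ℝ] (ℂ ⊗[ℝ] 𝔤) :=
  LinearMap.rTensor 𝔤 Complex.conjAe.toLinearMap

/-- The complexification `𝔥` of a Lie subalgebra `𝔱` of `𝔤`, as a subspace of `ℂ ⊗ 𝔤`. -/
abbrev cartan (𝔱 : LieSubalgebra ℝ 𝔤) : Submodule ℂ (ℂ ⊗[ℝ] 𝔤) :=
  𝔱.toSubmodule.baseChange ℂ

/-- The roots of `ℂ ⊗ 𝔤` with respect to `𝔥`: the non-zero functionals with a non-zero root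
vector. -/
def IsRoot (𝔱 : LieSubalgebra ℝ 𝔤) (α : Module.Dual ℂ (cartan 𝔱)) : Prop :=
  α ≠ 0 ∧ ∃ x : ℂ ⊗[ℝ] 𝔤, x ≠ 0 ∧ ∀ h : cartan 𝔱, ⁅(h : ℂ ⊗[ℝ] 𝔤), x⁆ = α h • x

/-- The root system `R`, as a type. -/
abbrev Root (𝔱 : LieSubalgebra ℝ 𝔤) : Type _ :=
  {α : Module.Dual ℂ (cartan 𝔱) // IsRoot 𝔱 α}

/-- A choice `R = R₊ ⊔ (-R₊)` of positive roots; `P` is `R₊`. -/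
structure IsPositiveSystem (𝔱 : LieSubalgebra ℝ 𝔤)
    (P : Finset (Module.Dual ℂ (cartan 𝔱))) : Prop where
  isRoot : ∀ α ∈ P, IsRoot 𝔱 α
  neg_notMem : ∀ α ∈ P, -α ∉ P
  mem_or_neg_mem : ∀ α, IsRoot 𝔱 α → α ∈ P ∨ -α ∈ P
  add_mem : ∀ α ∈ P, ∀ β ∈ P, IsRoot 𝔱 (α + β) → α + β ∈ P

open Classical in
/-- Given a basis of `ℂ ⊗ 𝔤` labelled by `1, …, l` and by the roots, the basis vector labelled
by the functional `α`; it is `0` if `α` is not a root. -/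
def rootVector {𝔱 : LieSubalgebra ℝ 𝔤} {l : ℕ}
    (e : Module.Basis (Fin l ⊕ Root 𝔱) ℂ (ℂ ⊗[ℝ] 𝔤)) (α : Module.Dual ℂ (cartan 𝔱)) :
    ℂ ⊗[ℝ] 𝔤 :=
  if hα : IsRoot 𝔱 α then e (Sum.inr ⟨α, hα⟩) else 0

/-- A Chevalley basis of `ℂ ⊗ 𝔤` with respect to `𝔥`, adapted to the compact real form `𝔤`:
a basis `H₁, …, H_l` of `𝔥` together with root vectors `τ_α` such that
`[τ_α, τ_{-α}] = -H_α`, where `H_α ∈ 𝔥` satisfies `α(H_α) = 2`, such that `τ_{-α}` is the complex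
conjugate of `τ_α`, and such that the structure constants in `[τ_α, τ_β] = N_{αβ} τ_{α+β}` are real
(so that `N_{-α,-β} = N_{αβ}`). -/
structure ChevalleyBasis (𝔱 : LieSubalgebra ℝ 𝔤) (l : ℕ) where
  /-- The family of all `H_i` and `τ_α`. -/
  basis : Module.Basis (Fin l ⊕ Root 𝔱) ℂ (ℂ ⊗[ℝ] 𝔤)
  /-- The vectors `H_i`. -/
  cartanVec : Fin l → cartan 𝔱
  /-- The coroots `H_α`. -/
  coroot : Module.Dual ℂ (cartan 𝔱) → cartan 𝔱
  basis_inl : ∀ i, basis (Sum.inl i) = cartanVec i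
  lie_cartan : ∀ (h : cartan 𝔱) (α : Root 𝔱),
    ⁅(h : ℂ ⊗[ℝ] 𝔤), basis (Sum.inr α)⁆ = α.1 h • basis (Sum.inr α)
  lie_neg : ∀ α, IsRoot 𝔱 α →
    ⁅rootVector basis α, rootVector basis (-α)⁆ = -(coroot α : ℂ ⊗[ℝ] 𝔤)
  apply_coroot : ∀ α, IsRoot 𝔱 α → α (coroot α) = 2
  conj_rootVector : ∀ α, IsRoot 𝔱 α → conj 𝔤 (rootVector basis α) = rootVector basis (-α)
  lie_rootVector : ∀ α β, IsRoot 𝔱 α → IsRoot 𝔱 β → α + β ≠ 0 →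
    ∃ N : ℝ, ⁅rootVector basis α, rootVector basis β⁆ = (N : ℂ) • rootVector basis (α + β)

end LieAlgebraData

section Ghosts

variable {𝔤 : Type*} [LieRing 𝔤] [LieAlgebra ℝ 𝔤]

variable (𝔤) in
/-- The ghost sector `𝒞 = ⋀ 𝔤*` (with complex coefficients). -/
abbrev Ghost : Type _ := ExteriorAlgebra ℂ (Module.Dual ℂ (ℂ ⊗[ℝ] 𝔤))

/-- Exterior multiplication by the one-form `θ`. -/
def wedge (θ : Module.Dual ℂ (ℂ ⊗[ℝ] 𝔤)) : Module.End ℂ (Ghost 𝔤) :=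
  LinearMap.mulLeft ℂ (ExteriorAlgebra.ι ℂ θ)

/-- Substitution (contraction) of the vector `x`. -/
def contract (x : ℂ ⊗[ℝ] 𝔤) : Module.End ℂ (Ghost 𝔤) :=
  CliffordAlgebra.contractLeft (Q := 0) (Module.Dual.eval ℂ (ℂ ⊗[ℝ] 𝔤) x)

variable [Module.Finite ℝ 𝔤] {𝔱 : LieSubalgebra ℝ 𝔤} {l : ℕ}

namespace ChevalleyBasis

variable (C : ChevalleyBasis 𝔱 l)

/-- The root vector `τ_α` (zero if `α` is not a root). -/
def τ (α : Module.Dual ℂ (cartan 𝔱)) : ℂ ⊗[ℝ] 𝔤 := rootVector C.basis α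

open Classical in
/-- The form `θ^α` dual to the root vector `τ_α` (zero if `α` is not a root). -/
def θ (α : Module.Dual ℂ (cartan 𝔱)) : Module.Dual ℂ (ℂ ⊗[ℝ] 𝔤) :=
  if hα : IsRoot 𝔱 α then C.basis.coord (Sum.inr ⟨α, hα⟩) else 0

/-- The ghost operator `c^α`: multiplication by `θ^{-α}`. -/
def c (α : Module.Dual ℂ (cartan 𝔱)) : Module.End ℂ (Ghost 𝔤) := wedge (C.θ (-α))

/-- The anti-ghost operator `b_α`: substitution of `τ_α`. -/
def b (α : Module.Dual ℂ (cartan 𝔱)) : Module.End ℂ (Ghost 𝔤) := contract (C.τ α)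

/-- The ghost operator `c^i`: multiplication by the form dual to `H_i`. -/
def cCartan (i : Fin l) : Module.End ℂ (Ghost 𝔤) := wedge (C.basis.coord (Sum.inl i))

/-- The anti-ghost operator `b_i`: substitution of `H_i`. -/
def bCartan (i : Fin l) : Module.End ℂ (Ghost 𝔤) := contract (C.cartanVec i : ℂ ⊗[ℝ] 𝔤)

/-- The labels `1, …, l` and the roots form a finite set. -/
@[reducible] def fintypeIndex : Fintype (Fin l ⊕ Root 𝔱) :=
  letI := Module.Finite.finite_basis C.basis
  Fintype.ofFinite _

/-- The Koszul operator of the coadjoint action, `L_x = - ∑_k θ^k ∧ i_{[x, e_k]}`, where `e_k` runs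
over the vectors of the Chevalley basis and `θ^k` over the dual forms. It is used for root vectors
`x = τ_α`, for which normal ordering has no effect. -/
def koszul (x : ℂ ⊗[ℝ] 𝔤) : Module.End ℂ (Ghost 𝔤) :=
  letI := C.fintypeIndex
  (-1 : ℂ) • ∑ k, wedge (C.basis.coord k) * contract ⁅x, C.basis k⁆

/-- The normally ordered ghost operator `L_H` of `H ∈ 𝔥`. -/
def ghostCartan (P : Finset (Module.Dual ℂ (cartan 𝔱))) (h : cartan 𝔱) :
    Module.End ℂ (Ghost 𝔤) :=
  (-1 : ℂ) • (∑ β ∈ P, β h • (C.c (-β) * C.b β) + ∑ β ∈ P, β h • (C.b (-β) * C.c β))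

/-- The anomalous (normally ordered) ghost differential
`d = ½ ∑_{α>0} c^{-α} L_α + ½ ∑_{α>0} L_{-α} c^α + ½ ∑_i c^i L_i`. -/
def ghostDiff (P : Finset (Module.Dual ℂ (cartan 𝔱))) : Module.End ℂ (Ghost 𝔤) :=
  (1 / 2 : ℂ) • ∑ α ∈ P, C.c (-α) * C.koszul (C.τ α)
    + (1 / 2 : ℂ) • ∑ α ∈ P, C.koszul (C.τ (-α)) * C.c α
    + (1 / 2 : ℂ) • ∑ i, C.cCartan i * C.ghostCartan P (C.cartanVec i)

/-- The operator `gh̄ = ∑_{α>0} c^{-α} b_α` counting ghosts. -/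
def ghBar (P : Finset (Module.Dual ℂ (cartan 𝔱))) : Module.End ℂ (Ghost 𝔤) :=
  ∑ α ∈ P, C.c (-α) * C.b α

/-- The operator `gh = ∑_{α>0} b_{-α} c^α` counting anti-ghosts. -/
def gh (P : Finset (Module.Dual ℂ (cartan 𝔱))) : Module.End ℂ (Ghost 𝔤) :=
  ∑ α ∈ P, C.b (-α) * C.c α

/-- The relative ghost number operator. -/
def ghRel (P : Finset (Module.Dual ℂ (cartan 𝔱))) : Module.End ℂ (Ghost 𝔤) :=
  C.ghBar P - C.gh P

/-- A total order of the labels of the Chevalley basis, fixed once and for all. -/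
@[reducible] def orderIndex (_C : ChevalleyBasis 𝔱 l) : LinearOrder (Fin l ⊕ Root 𝔱) :=
  open Classical in linearOrderOfSTO WellOrderingRel

open Classical in
/-- The basis of the ghost sector formed by the exterior monomials in the forms dual to the
Chevalley basis; it is labelled by the finite sets of labels. -/
def monomials : Module.Basis (Finset (Fin l ⊕ Root 𝔱)) ℂ (Ghost 𝔤) :=
  letI := C.orderIndex
  haveI := Module.Finite.finite_basis C.basis
  C.basis.dualBasis.ExteriorAlgebra

open Classical in
/-- The ghost vacuum `ω = θ^{-α₁} ∧ … ∧ θ^{-α_m}`, the top form over the negative root vectors. -/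
def vacuum (P : Finset (Module.Dual ℂ (cartan 𝔱))) : Ghost 𝔤 :=
  letI := C.fintypeIndex
  C.monomials {k | ∃ β : Root 𝔱, k = Sum.inr β ∧ -β.1 ∈ P}

open Classical in
/-- The anomaly coefficients `r_α = sign(α) ⟨χ + 2ϱ, H_α⟩`, where `2ϱ` is the sum of the positive
roots. -/
def anomaly (P : Finset (Module.Dual ℂ (cartan 𝔱))) (χ : Module.Dual ℂ (ℂ ⊗[ℝ] 𝔤))
    (α : Module.Dual ℂ (cartan 𝔱)) : ℝ :=
  (if α ∈ P then 1 else -1) *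
    (χ (C.coroot α : ℂ ⊗[ℝ] 𝔤) + (∑ β ∈ P, β) (C.coroot α)).re

/-- The squared norm of a monomial of the relative ghost sector, in terms of the set `S` of its
factors: `∏_{β ∈ S} 1/r_β · ∏_{α>0} r_α`. Thus
`‖b_{-α₁} ⋯ b_{-α_k} c^{-β₁} ⋯ c^{-β_s} ω‖² = r_{α₁} ⋯ r_{α_k} / (r_{β₁} ⋯ r_{β_s})`. -/
def weight (P : Finset (Module.Dual ℂ (cartan 𝔱))) (χ : Module.Dual ℂ (ℂ ⊗[ℝ] 𝔤))
    (S : Finset (Fin l ⊕ Root 𝔱)) : ℝ :=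
  (∏ k ∈ S, Sum.elim (fun _ => (1 : ℝ)) (fun β : Root 𝔱 => (C.anomaly P χ β.1)⁻¹) k) *
    ∏ α ∈ P, C.anomaly P χ α

end ChevalleyBasis

end Ghosts

section Complex

variable {𝔤 : Type*} [LieRing 𝔤] [LieAlgebra ℝ 𝔤] [Module.Finite ℝ 𝔤]
  {𝔱 : LieSubalgebra ℝ 𝔤} {l : ℕ}
  {V : Type*} [NormedAddCommGroup V] [InnerProductSpace ℂ V]

/-- The quotient `Z / B` of two subspaces of a vector space (literally `Z / (Z ∩ B)`). -/
abbrev Subquotient {M : Type*} [AddCommGroup M] [Module ℂ M] (Z B : Submodule ℂ M) : Type _ :=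
  Z ⧸ B.submoduleOf Z

variable (𝔤 V) in
/-- The total differential space `𝒞(V) = ⋀ 𝔤* ⊗ V`. -/
abbrev Cochain : Type _ := Ghost 𝔤 ⊗[ℂ] V

/-- An operator of the ghost sector, acting on cochains. -/
abbrev onGhost (A : Module.End ℂ (Ghost 𝔤)) : Module.End ℂ (Cochain 𝔤 V) :=
  TensorProduct.map A LinearMap.id

/-- A constrained system: a Chevalley basis, the positive roots, the operators on `V` of the real
Lie algebra `𝔤`, and the functional `χ` (extended complex linearly). -/
structure System (𝔱 : LieSubalgebra ℝ 𝔤) (l : ℕ) (V : Type*) [NormedAddCommGroup V]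
    [InnerProductSpace ℂ V] where
  /-- The Chevalley basis. -/
  C : ChevalleyBasis 𝔱 l
  /-- The set of positive roots. -/
  P : Finset (Module.Dual ℂ (cartan 𝔱))
  /-- The operators on `V`. -/
  ρ : 𝔤 →ₗ[ℝ] (V →ₗ[ℂ] V)
  /-- The functional defining the constraints. -/
  χ : Module.Dual ℂ (ℂ ⊗[ℝ] 𝔤)

/-- The standing assumptions. The set `P` is a system of positive roots; `ρ` is a representation of
`𝔤` by operators that are skew with respect to the scalar product of `V`; `χ` belongs to `𝔥*`, and
it is regular and dominant, that is, it lies in the interior of the positive Weyl chamber. -/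
structure System.IsRegularDominant (S : System 𝔱 l V) : Prop where
  positive : IsPositiveSystem 𝔱 S.P
  map_lie : ∀ x y : 𝔤, S.ρ ⁅x, y⁆ = S.ρ x ∘ₗ S.ρ y - S.ρ y ∘ₗ S.ρ x
  skew : ∀ (x : 𝔤) (u v : V), inner ℂ (S.ρ x u) v = -inner ℂ u (S.ρ x v)
  χ_root : ∀ α, IsRoot 𝔱 α → S.χ (S.C.τ α) = 0
  χ_real : ∀ α ∈ S.P, (S.χ (S.C.coroot α : ℂ ⊗[ℝ] 𝔤)).im = 0
  χ_pos : ∀ α ∈ S.P, 0 < (S.χ (S.C.coroot α : ℂ ⊗[ℝ] 𝔤)).re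

namespace System

variable (S : System 𝔱 l V)

/-- The shifted operators `ℒ_x = ρ(x) - ⟨χ, x⟩` on `V`, for `x` in the complexification. -/
def constraint (x : ℂ ⊗[ℝ] 𝔤) : Module.End ℂ V :=
  S.ρ.liftBaseChange ℂ x - S.χ x • LinearMap.id

/-- The space `V(𝔤, χ)` of the vectors annihilated by `ℒ_α`, `α > 0`, and `ℒ_H`, `H ∈ 𝔥`. -/
def borelInvariants : Submodule ℂ V :=
  (⨅ α ∈ S.P, LinearMap.ker (S.constraint (S.C.τ α))) ⊓
    ⨅ h : cartan 𝔱, LinearMap.ker (S.constraint (h : ℂ ⊗[ℝ] 𝔤))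

/-- The differential `D = ∑_{α ∈ R} c^{-α} ⊗ ℒ_α + ∑_i c^i ⊗ ℒ_i + d ⊗ 1`. -/
def D : Module.End ℂ (Cochain 𝔤 V) :=
  ∑ α ∈ S.P, (TensorProduct.map (S.C.c (-α)) (S.constraint (S.C.τ α))
      + TensorProduct.map (S.C.c α) (S.constraint (S.C.τ (-α))))
    + ∑ i, TensorProduct.map (S.C.cCartan i) (S.constraint (S.C.cartanVec i : ℂ ⊗[ℝ] 𝔤))
    + onGhost (S.C.ghostDiff S.P)

/-- The total action `L_H^tot = 1 ⊗ ℒ_H + L_H ⊗ 1` of `H ∈ 𝔥`. -/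
def totalCartan (h : cartan 𝔱) : Module.End ℂ (Cochain 𝔤 V) :=
  TensorProduct.map LinearMap.id (S.constraint (h : ℂ ⊗[ℝ] 𝔤)) + onGhost (S.C.ghostCartan S.P h)

/-- The relative differential space `𝒞_rel(V)`. -/
def Crel : Submodule ℂ (Cochain 𝔤 V) :=
  (⨅ h : cartan 𝔱, LinearMap.ker (S.totalCartan h)) ⊓
    ⨅ i, LinearMap.ker (onGhost (V := V) (S.C.bCartan i))

/-- The anomalous complex `𝒜 = ker D²`. -/
def A : Submodule ℂ (Cochain 𝔤 V) := LinearMap.ker (S.D * S.D)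

/-- The anomalous relative complex `𝒜_rel`; its differential is the restriction of `D`. -/
def Arel : Submodule ℂ (Cochain 𝔤 V) := S.A ⊓ S.Crel

/-- The relative cochains `𝒜_rel^r` of relative ghost number `r`. -/
def ArelDeg (r : ℤ) : Submodule ℂ (Cochain 𝔤 V) :=
  S.Arel ⊓ Module.End.eigenspace (onGhost (V := V) (S.C.ghRel S.P)) (r : ℂ)

/-- The relative cocycles `Z^r_rel`. -/
def Zrel (r : ℤ) : Submodule ℂ (Cochain 𝔤 V) := S.ArelDeg r ⊓ LinearMap.ker S.D

/-- The relative coboundaries `B^r_rel`. -/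
def Brel (r : ℤ) : Submodule ℂ (Cochain 𝔤 V) := (S.ArelDeg (r - 1)).map S.D

/-- The anomalous relative cohomology `H^r_rel = Z^r_rel / B^r_rel`. -/
abbrev Hrel (r : ℤ) : Type _ := Subquotient (S.Zrel r) (S.Brel r)

/-- The `V`-valued coefficient of a cochain at a monomial of the ghost sector. -/
def coeff (k : Finset (Fin l ⊕ Root 𝔱)) : Cochain 𝔤 V →ₗ[ℂ] V :=
  TensorProduct.lid ℂ V ∘ₗ LinearMap.rTensor V (S.C.monomials.coord k)

open Classical in
/-- The Kähler pairing: distinct monomials are orthogonal, the squared norms of the monomials are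
those given by `weight` (so that `ω` has norm one), and `V` carries its own scalar product. Only its
restriction to `𝒞_rel(V)` is used; there it is the positive scalar product for which `c^α` and
`r_α⁻¹ b_{-α}` are adjoint. -/
def pairing (Ψ Φ : Cochain 𝔤 V) : ℂ :=
  letI := S.C.fintypeIndex
  ∑ k : Finset (Fin l ⊕ Root 𝔱),
    (S.C.weight S.P S.χ k : ℂ) * inner ℂ (S.coeff k Ψ) (S.coeff k Φ)

/-- The relation `D_rel† Ψ = Ξ`, where `D_rel†` is the adjoint of the restriction `D_rel` of `D` to
`𝒞_rel(V)` with respect to the Kähler pairing of `𝒞_rel(V)`. -/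
def IsAdjointValue (Ψ Ξ : Cochain 𝔤 V) : Prop :=
  Ξ ∈ S.Crel ∧ ∀ Φ ∈ S.Crel, S.pairing Ξ Φ = S.pairing Ψ (S.D Φ)

/-- The space of anomalous harmonic cochains: the kernel on `𝒜_rel` of the Laplace operator
`Δ = D_rel D_rel† + D_rel† D_rel`. -/
def harmonic : Submodule ℂ (Cochain 𝔤 V) where
  carrier := {Ψ | Ψ ∈ S.Arel ∧ ∃ Ξ Υ, S.IsAdjointValue Ψ Ξ ∧ S.IsAdjointValue (S.D Ψ) Υ ∧
    S.D Ξ + Υ = 0}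
  add_mem' := by
    rintro Ψ Ψ' ⟨h, Ξ, Υ, h1, h2, h3⟩ ⟨h', Ξ', Υ', h1', h2', h3'⟩
    refine ⟨add_mem h h', Ξ + Ξ', Υ + Υ', ⟨add_mem h1.1 h1'.1, fun Φ hΦ => ?_⟩,
      ⟨add_mem h2.1 h2'.1, fun Φ hΦ => ?_⟩, ?_⟩
    · have e := h1.2 Φ hΦ
      have e' := h1'.2 Φ hΦ
      simp only [pairing, map_add, inner_add_left, mul_add, Finset.sum_add_distrib] at e e' ⊢
      rw [e, e']
    · have e := h2.2 Φ hΦ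
      have e' := h2'.2 Φ hΦ
      simp only [pairing, map_add, inner_add_left, mul_add, Finset.sum_add_distrib] at e e' ⊢
      rw [e, e']
    · rw [map_add, add_add_add_comm, h3, h3', add_zero]
  zero_mem' := by
    refine ⟨zero_mem _, 0, 0, ⟨zero_mem _, fun Φ _ => ?_⟩, ⟨zero_mem _, fun Φ _ => ?_⟩, by simp⟩
    · simp [pairing]
    · simp [pairing]
  smul_mem' := by
    rintro a Ψ ⟨h, Ξ, Υ, h1, h2, h3⟩
    refine ⟨Submodule.smul_mem _ a h, a • Ξ, a • Υ,
      ⟨Submodule.smul_mem _ a h1.1, fun Φ hΦ => ?_⟩,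
      ⟨Submodule.smul_mem _ a h2.1, fun Φ hΦ => ?_⟩, ?_⟩
    · have e := h1.2 Φ hΦ
      simp only [pairing, map_smul, inner_smul_left, mul_left_comm _ ((starRingEnd ℂ) a),
        ← Finset.mul_sum] at e ⊢
      rw [e]
    · have e := h2.2 Φ hΦ
      simp only [pairing, map_smul, inner_smul_left, mul_left_comm _ ((starRingEnd ℂ) a),
        ← Finset.mul_sum] at e ⊢
      rw [e]
    · rw [map_smul, ← smul_add, h3, smul_zero]

/-- The harmonic cochains of bidegree `(p, q)`. At ghost number zero, the root component is the one
of bidegree `(0, 0)`. -/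
def harmonicBidegree (p q : ℕ) : Submodule ℂ (Cochain 𝔤 V) :=
  S.harmonic ⊓ Module.End.eigenspace (onGhost (V := V) (S.C.ghBar S.P)) (p : ℂ) ⊓
    Module.End.eigenspace (onGhost (V := V) (S.C.gh S.P)) (q : ℂ)

end System

end Complex

end AnomalousLie

/-!
The anomalous differential is a Chevalley–Eilenberg differential twisted by a one-form. Let `λ` be
the one-form that equals `χ + 2ϱ` on `𝔥` and vanishes on the root vectors. Undoing the normal
ordering gives `D = d_V - λ ∧`, where `d_V` is the usual differential with coefficients in `V`
(`RootBasis.totalDiff_eq`). Since `d_V² = 0` and `[τ_α, τ_{-α}] = -H_α`, the square `D² = -dλ ∧` is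
minus multiplication `L` by the Kähler form `∑_{α>0} ⟨χ + 2ϱ, H_α⟩ θ^α ∧ θ^{-α}`
(`RootBasis.totalDiff_mul_self`), so that `𝒜` is the kernel of `L`.

When no `⟨χ + 2ϱ, H_α⟩` vanishes, `L` has a dual operator `Λ` with `[L, Λ] = gh_rel`
(`RootBasis.kaehler_mul_dualKaehler`). For a relative cocycle `Ψ` of ghost number `r` in `𝒜` this
gives `D (D Λ Ψ) = -L Λ Ψ = -r Ψ`, hence an explicit primitive `-r⁻¹ D Λ Ψ`, which lies again in the
kernel of `L` and in the relative complex (`RootBasis.exists_primitive`); no Hodge theory is needed.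

The numbers `r_α` are positive because `⟨2ϱ, H_α⟩ ≥ 0` for every positive root `α`. With
`[τ_{-α}, [τ_α, τ_γ]] = -a(γ) τ_γ`, the Jacobi identity reads `β(H_α) = a(β - α) - a(β)` for
`β ≠ ±α`, the coefficients `a(γ)` are non-negative by the definiteness of the Hermitian form
`κ(x, x̄)`, and the sum over the positive roots `β` telescopes
(`RootBasis.sum_apply_coroot_nonneg`).

For the harmonic space, the relative cochains of bidegree `(0, 0)` are the `ω ⊗ φ`
(`System.eq_vacuum_tmul`), on which `D (ω ⊗ φ) = ∑_{α>0} c^{-α} ω ⊗ ℒ_α φ` once `ℒ_H φ = 0`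
(`System.D_vacuum_tmul`). Positivity of the Kähler pairing forces harmonic cochains to be closed,
and so `φ` is annihilated by the `ℒ_α`. Conversely, the coefficient of `D Φ` at `ω` is a sum of
values of the `ℒ_{-α}`, `α > 0`, which are adjoint to the `-ℒ_α`; so it is orthogonal to the
invariant vectors `φ`, and `D† (ω ⊗ φ) = 0` (`System.pairing_vacuum_D`).

The computations with `D` are carried out for operators `W θ`, `I x` and `ρ x` in an arbitrary
algebra that satisfy the relations of exterior multiplication, substitution and a representation.
-/

namespace AnomalousLie

/-! ### Ghosts and the Chevalley–Eilenberg differential -/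

section GhostAlgebra

variable {L : Type*} [LieRing L] [LieAlgebra ℂ L] {A : Type*} [Ring A] [Algebra ℂ A]

/-- The canonical anticommutation relations between the ghosts `W θ` (exterior multiplication by
one-forms) and the anti-ghosts `I x` (substitution of vectors) in an arbitrary algebra `A`. -/
structure IsGhostPair (W : Module.Dual ℂ L →ₗ[ℂ] A) (I : L →ₗ[ℂ] A) : Prop where
  mul_self_left : ∀ θ, W θ * W θ = 0
  left_left : ∀ θ η, W θ * W η = -(W η * W θ)
  right_right : ∀ x y, I x * I y = -(I y * I x)
  right_left : ∀ x θ, I x * W θ = θ x • (1 : A) - W θ * I x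

/-- The composition `θ ∘ ad x`, up to sign the coadjoint action of `x` on `θ`. -/
def compAd (θ : Module.Dual ℂ L) (x : L) : Module.Dual ℂ L :=
  θ ∘ₗ (LieAlgebra.ad ℂ L x : Module.End ℂ L)

@[simp] lemma compAd_apply (θ : Module.Dual ℂ L) (x y : L) : compAd θ x y = θ ⁅x, y⁆ := rfl

variable {ι : Type*} [Fintype ι] (B : Module.Basis ι ℂ L)

lemma sum_smul_coord (θ : Module.Dual ℂ L) : ∑ k, θ (B k) • B.coord k = θ := by
  classical
  refine B.ext fun j => ?_
  simp

lemma sum_smul_left {N : Type*} [AddCommGroup N] [Module ℂ N] (W : Module.Dual ℂ L →ₗ[ℂ] N)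
    (θ : Module.Dual ℂ L) : ∑ k, θ (B k) • W (B.coord k) = W θ := by
  simp_rw [← map_smul, ← map_sum, sum_smul_coord]

lemma sum_smul_right {N : Type*} [AddCommGroup N] [Module ℂ N] (f : L →ₗ[ℂ] N) (x : L) :
    ∑ k, B.coord k x • f (B k) = f x := by
  simp_rw [← map_smul, ← map_sum, Module.Basis.coord_apply, B.sum_repr]

/-- The operator `ad x` may be moved from the forms of the dual basis to the vectors of the
basis. -/
lemma sum_compAd (W : Module.Dual ℂ L →ₗ[ℂ] A) (x : L) (f : L →ₗ[ℂ] A) :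
    ∑ k, W (compAd (B.coord k) x) * f (B k) = ∑ k, W (B.coord k) * f ⁅x, B k⁆ := by
  have h1 : ∀ k, W (compAd (B.coord k) x) * f (B k)
      = ∑ j, B.coord k ⁅x, B j⁆ • (W (B.coord j) * f (B k)) := fun k => by
    rw [← sum_smul_left B W (compAd (B.coord k) x), Finset.sum_mul]
    simp only [smul_mul_assoc, compAd_apply]
  have h2 : ∀ j, W (B.coord j) * f ⁅x, B j⁆
      = ∑ k, B.coord k ⁅x, B j⁆ • (W (B.coord j) * f (B k)) := fun j => by
    rw [← sum_smul_right B f ⁅x, B j⁆, Finset.mul_sum]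
    simp only [mul_smul_comm]
  rw [Finset.sum_congr rfl fun k _ => h1 k, Finset.sum_congr rfl fun k _ => h2 k]
  exact Finset.sum_comm

/-- The structure constants contracted with two ghosts may be read off from the action on the forms
of the dual basis or from the brackets of the vectors of the basis. -/
lemma sum_left_mul_compAd (W : Module.Dual ℂ L →ₗ[ℂ] A) (f : L →ₗ[ℂ] A) :
    ∑ k, ∑ j, W (B.coord j) * W (compAd (B.coord k) (B j)) * f (B k)
      = ∑ i, ∑ j, W (B.coord i) * W (B.coord j) * f ⁅B i, B j⁆ := by
  rw [Finset.sum_comm]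
  refine Finset.sum_congr rfl fun i _ => ?_
  simp_rw [mul_assoc, ← Finset.mul_sum, sum_compAd]

variable (W : Module.Dual ℂ L →ₗ[ℂ] A) (I : L →ₗ[ℂ] A)

/-- The coadjoint action `x ↦ -∑_k θ^k ∧ i_{[x, e_k]}` on the ghost sector. -/
def coad : L →ₗ[ℂ] A :=
  -∑ k, LinearMap.mulLeft ℂ (W (B.coord k)) ∘ₗ I ∘ₗ
    (-(LieAlgebra.ad ℂ L (B k) : Module.End ℂ L))

lemma coad_apply (x : L) : coad B W I x = -∑ k, W (B.coord k) * I ⁅x, B k⁆ := by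
  simp only [coad, LinearMap.neg_apply, LinearMap.sum_apply, LinearMap.comp_apply,
    LieAlgebra.ad_apply, lie_skew, LinearMap.mulLeft_apply]

/-- The Chevalley–Eilenberg differential of the ghost sector, `½ ∑_k θ^k ∧ L_{e_k}`. -/
def ceDiff : A := (1 / 2 : ℂ) • ∑ k, W (B.coord k) * coad B W I (B k)

/-- The number operator `∑_k θ^k ∧ i_{e_k}` of the ghost sector. -/
def ghostNumber : A := ∑ k, W (B.coord k) * I (B k)

namespace IsGhostPair

variable {W I} (h : IsGhostPair W I)

include h

lemma coad_mul_right (x y : L) :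
    coad B W I x * I y = I y * coad B W I x + I ⁅x, y⁆ := by
  have h1 : ∀ k, W (B.coord k) * I ⁅x, B k⁆ * I y
      = I y * (W (B.coord k) * I ⁅x, B k⁆) - B.coord k y • I ⁅x, B k⁆ := fun k => by
    rw [mul_assoc, h.right_right, ← mul_assoc, h.right_left, mul_neg, ← mul_assoc, sub_mul,
      smul_mul_assoc, one_mul]
    abel
  have h2 := sum_smul_right B (I ∘ₗ (LieAlgebra.ad ℂ L x : Module.End ℂ L)) y
  simp only [LinearMap.comp_apply, LieAlgebra.ad_apply] at h2
  rw [coad_apply, neg_mul, Finset.sum_mul, Finset.sum_congr rfl fun k _ => h1 k,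
    Finset.sum_sub_distrib, h2, ← Finset.mul_sum, mul_neg]
  abel

lemma coad_mul_left (x : L) (θ : Module.Dual ℂ L) :
    coad B W I x * W θ = W θ * coad B W I x - W (compAd θ x) := by
  have h1 : ∀ k, W (B.coord k) * I ⁅x, B k⁆ * W θ
      = W θ * (W (B.coord k) * I ⁅x, B k⁆) + compAd θ x (B k) • W (B.coord k) := fun k => by
    rw [mul_assoc, h.right_left, ← mul_assoc, h.left_left θ, compAd_apply, mul_sub, mul_smul_comm,
      mul_one, neg_mul, mul_assoc]
    abel
  rw [coad_apply, neg_mul, Finset.sum_mul, Finset.sum_congr rfl fun k _ => h1 k,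
    Finset.sum_add_distrib, sum_smul_left, ← Finset.mul_sum, mul_neg]
  abel

lemma coad_mul_coad (x y : L) :
    coad B W I x * coad B W I y = coad B W I y * coad B W I x + coad B W I ⁅x, y⁆ := by
  have h1 : ∀ k, coad B W I x * (W (B.coord k) * I ⁅y, B k⁆)
      = W (B.coord k) * I ⁅y, B k⁆ * coad B W I x + W (B.coord k) * I ⁅x, ⁅y, B k⁆⁆
        - W (compAd (B.coord k) x) * I ⁅y, B k⁆ := fun k => by
    rw [← mul_assoc, h.coad_mul_left, sub_mul, mul_assoc, h.coad_mul_right, mul_add, mul_assoc]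
  have h2 := sum_compAd B W x (I ∘ₗ (LieAlgebra.ad ℂ L y : Module.End ℂ L))
  simp only [LinearMap.comp_apply, LieAlgebra.ad_apply] at h2
  have h3 : ∀ k, I ⁅⁅x, y⁆, B k⁆ = I ⁅x, ⁅y, B k⁆⁆ - I ⁅y, ⁅x, B k⁆⁆ :=
    fun k => by rw [lie_lie, map_sub]
  rw [coad_apply B W I y, mul_neg, Finset.mul_sum, Finset.sum_congr rfl fun k _ => h1 k,
    Finset.sum_sub_distrib, Finset.sum_add_distrib, h2, coad_apply B W I ⁅x, y⁆]
  simp_rw [h3, mul_sub, Finset.sum_sub_distrib, ← Finset.sum_mul, neg_mul]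
  abel

lemma ceDiff_mul_right (y : L) :
    ceDiff B W I * I y = coad B W I y - I y * ceDiff B W I := by
  have h1 : ∀ k, W (B.coord k) * coad B W I (B k) * I y
      = B.coord k y • coad B W I (B k) - I y * (W (B.coord k) * coad B W I (B k))
        - W (B.coord k) * I ⁅y, B k⁆ := fun k => by
    rw [mul_assoc, h.coad_mul_right, mul_add, ← mul_assoc, ← mul_assoc, h.right_left,
      ← lie_skew (B k) y, map_neg, sub_mul, smul_mul_assoc, one_mul, mul_neg]
    abel
  rw [ceDiff, smul_mul_assoc, Finset.sum_mul, Finset.sum_congr rfl fun k _ => h1 k,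
    Finset.sum_sub_distrib, Finset.sum_sub_distrib, sum_smul_right B (coad B W I) y,
    ← Finset.mul_sum, sub_eq_add_neg _ (∑ k, W (B.coord k) * I ⁅y, B k⁆), ← coad_apply,
    mul_smul_comm]
  module

lemma ceDiff_mul_left (θ : Module.Dual ℂ L) :
    ceDiff B W I * W θ = -(W θ * ceDiff B W I)
      - (1 / 2 : ℂ) • ∑ k, W (B.coord k) * W (compAd θ (B k)) := by
  have h1 : ∀ k, W (B.coord k) * coad B W I (B k) * W θ
      = -(W θ * (W (B.coord k) * coad B W I (B k)))
        - W (B.coord k) * W (compAd θ (B k)) := fun k => by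
    rw [mul_assoc, h.coad_mul_left, ← mul_assoc (W θ), h.left_left θ, mul_sub, neg_mul, neg_neg,
      mul_assoc]
  rw [ceDiff, smul_mul_assoc, Finset.sum_mul, Finset.sum_congr rfl fun k _ => h1 k,
    Finset.sum_sub_distrib, Finset.sum_neg_distrib, ← Finset.mul_sum, mul_smul_comm]
  module

/-- A pair of ghosts antisymmetrizes the product of two operators of a representation of `L`. -/
lemma sum_mul_of_lie (f : L →ₗ[ℂ] A) (hf : ∀ x y, f x * f y = f y * f x + f ⁅x, y⁆) :
    ∑ i, ∑ j, W (B.coord i) * W (B.coord j) * f ⁅B i, B j⁆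
      = (2 : ℂ) • ∑ i, ∑ j, W (B.coord i) * W (B.coord j) * (f (B i) * f (B j)) := by
  have h1 : ∑ i, ∑ j, W (B.coord i) * W (B.coord j) * (f (B j) * f (B i))
      = -∑ i, ∑ j, W (B.coord i) * W (B.coord j) * (f (B i) * f (B j)) := by
    rw [Finset.sum_comm]
    simp_rw [← Finset.sum_neg_distrib]
    refine Finset.sum_congr rfl fun i _ => Finset.sum_congr rfl fun j _ => ?_
    rw [h.left_left, neg_mul]
  have h2 : ∀ i j, f ⁅B i, B j⁆ = f (B i) * f (B j) - f (B j) * f (B i) := fun i j => by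
    rw [hf]; abel
  simp_rw [h2, mul_sub, Finset.sum_sub_distrib, h1]
  module

/-- The Jacobi identity, contracted with three ghosts. -/
lemma sum_mul_coad_lie :
    ∑ i, ∑ j, W (B.coord i) * W (B.coord j) * coad B W I ⁅B i, B j⁆ = 0 := by
  set X : ι → ι → ι → A := fun i j k =>
    W (B.coord i) * W (B.coord j) * W (B.coord k) * I ⁅⁅B i, B j⁆, B k⁆ with hX
  have h0 : ∑ i, ∑ j, W (B.coord i) * W (B.coord j) * coad B W I ⁅B i, B j⁆
      = -∑ i, ∑ j, ∑ k, X i j k := by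
    simp_rw [coad_apply, mul_neg, Finset.mul_sum, Finset.sum_neg_distrib, hX, mul_assoc]
  have cyc : ∀ i j k, W (B.coord j) * W (B.coord k) * W (B.coord i)
      = W (B.coord i) * W (B.coord j) * W (B.coord k) := fun i j k => by
    rw [mul_assoc, h.left_left (B.coord k), mul_neg, ← mul_assoc, h.left_left (B.coord j), neg_mul,
      neg_neg]
  have hJ : ∀ i j k, X i j k + X j k i + X k i j = 0 := fun i j k => by
    simp only [hX]
    rw [cyc i j k, ← cyc k i j, ← mul_add, ← mul_add, ← map_add, ← map_add]
    have : ⁅⁅B i, B j⁆, B k⁆ + ⁅⁅B j, B k⁆, B i⁆ + ⁅⁅B k, B i⁆, B j⁆ = 0 := by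
      rw [← lie_skew ⁅B i, B j⁆ (B k), ← lie_skew ⁅B j, B k⁆ (B i), ← lie_skew ⁅B k, B i⁆ (B j),
        ← neg_eq_zero, ← lie_jacobi (B i) (B j) (B k)]
      abel
    rw [this, map_zero, mul_zero]
  have c1 : ∑ i, ∑ j, ∑ k, X j k i = ∑ i, ∑ j, ∑ k, X i j k := by
    rw [Finset.sum_comm]
    exact Finset.sum_congr rfl fun j _ => Finset.sum_comm
  have c2 : ∑ i, ∑ j, ∑ k, X k i j = ∑ i, ∑ j, ∑ k, X i j k :=
    calc ∑ i, ∑ j, ∑ k, X k i j = ∑ i, ∑ k, ∑ j, X k i j :=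
          Finset.sum_congr rfl fun i _ => Finset.sum_comm
      _ = _ := Finset.sum_comm
  have h3 : (3 : ℂ) • ∑ i, ∑ j, ∑ k, X i j k = 0 := by
    have : ∑ i, ∑ j, ∑ k, (X i j k + X j k i + X k i j) = 0 :=
      Finset.sum_eq_zero fun i _ => Finset.sum_eq_zero fun j _ => Finset.sum_eq_zero fun k _ =>
        hJ i j k
    simp_rw [Finset.sum_add_distrib] at this
    rw [c1, c2] at this
    rw [← this]; module
  rw [h0, (smul_eq_zero.mp h3).resolve_left (by norm_num), neg_zero]

lemma ceDiff_mul_self : ceDiff B W I * ceDiff B W I = 0 := by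
  have hc := h.sum_mul_of_lie B (coad B W I) (h.coad_mul_coad B)
  rw [h.sum_mul_coad_lie B] at hc
  have hc' := (smul_eq_zero.mp hc.symm).resolve_left (by norm_num)
  have h1 : ∀ i j, W (B.coord i) * coad B W I (B i) * (W (B.coord j) * coad B W I (B j))
      = W (B.coord i) * W (B.coord j) * (coad B W I (B i) * coad B W I (B j))
        - W (B.coord i) * W (compAd (B.coord j) (B i)) * coad B W I (B j) := fun i j => by
    rw [mul_assoc, ← mul_assoc (coad B W I (B i)), h.coad_mul_left, sub_mul, mul_sub, mul_assoc,
      mul_assoc, mul_assoc]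
  have h2 := sum_left_mul_compAd B W (coad B W I)
  rw [Finset.sum_comm, h.sum_mul_coad_lie B] at h2
  rw [ceDiff, smul_mul_smul_comm, Finset.sum_mul_sum]
  simp_rw [h1, Finset.sum_sub_distrib, hc', h2]
  simp

/-- The Chevalley–Eilenberg differential with coefficients in a representation `ρ` squares to
zero. -/
lemma sum_add_ceDiff_mul_self (ρ : L →ₗ[ℂ] A) (hρ : ∀ x y, ρ x * ρ y = ρ y * ρ x + ρ ⁅x, y⁆)
    (hW : ∀ x θ, ρ x * W θ = W θ * ρ x) (hI : ∀ x y, ρ x * I y = I y * ρ x) :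
    (∑ k, W (B.coord k) * ρ (B k) + ceDiff B W I) *
      (∑ k, W (B.coord k) * ρ (B k) + ceDiff B W I) = 0 := by
  have hd : ∀ x, ρ x * ceDiff B W I = ceDiff B W I * ρ x := fun x => by
    have hc : ∀ y, Commute (ρ x) (coad B W I y) := fun y => by
      rw [coad_apply]
      exact (Commute.sum_right _ _ _ fun k _ => Commute.mul_right (hW _ _) (hI _ _)).neg_right
    exact (Commute.sum_right _ _ _ fun k _ => Commute.mul_right (hW _ _) (hc _)).smul_right _
  have h1 : (∑ k, W (B.coord k) * ρ (B k)) * ∑ k, W (B.coord k) * ρ (B k)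
      = (1 / 2 : ℂ) • ∑ i, ∑ j, W (B.coord i) * W (B.coord j) * ρ ⁅B i, B j⁆ := by
    rw [h.sum_mul_of_lie B ρ hρ, smul_smul, Finset.sum_mul_sum]
    norm_num
    refine Finset.sum_congr rfl fun i _ => Finset.sum_congr rfl fun j _ => ?_
    rw [mul_assoc, ← mul_assoc (ρ _), hW, mul_assoc, mul_assoc]
  have h2 : ceDiff B W I * ∑ k, W (B.coord k) * ρ (B k)
      = -((∑ k, W (B.coord k) * ρ (B k)) * ceDiff B W I)
        - (1 / 2 : ℂ) • ∑ i, ∑ j, W (B.coord i) * W (B.coord j) * ρ ⁅B i, B j⁆ := by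
    rw [← sum_left_mul_compAd B W ρ, Finset.mul_sum, Finset.sum_mul, Finset.smul_sum,
      ← Finset.sum_neg_distrib, ← Finset.sum_sub_distrib]
    refine Finset.sum_congr rfl fun k _ => ?_
    rw [← mul_assoc, h.ceDiff_mul_left, mul_assoc, hd, sub_mul, neg_mul, smul_mul_assoc,
      Finset.sum_mul, mul_assoc]
  rw [mul_add, add_mul, add_mul, h.ceDiff_mul_self, h1, h2]
  abel

lemma ghostNumber_mul_left (θ : Module.Dual ℂ L) :
    ghostNumber B W I * W θ = W θ * (ghostNumber B W I + 1) := by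
  have h1 : ∀ k, W (B.coord k) * I (B k) * W θ
      = θ (B k) • W (B.coord k) + W θ * (W (B.coord k) * I (B k)) := fun k => by
    rw [mul_assoc, h.right_left, mul_sub, ← mul_assoc, h.left_left (B.coord k), ← mul_assoc,
      mul_smul_comm, mul_one]
    simp
  rw [ghostNumber, Finset.sum_mul, Finset.sum_congr rfl fun k _ => h1 k, Finset.sum_add_distrib,
    sum_smul_left, ← Finset.mul_sum, mul_add, mul_one, add_comm]

lemma ghostNumber_mul_right (x : L) :
    ghostNumber B W I * I x = I x * (ghostNumber B W I - 1) := by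
  have h1 : ∀ k, W (B.coord k) * I (B k) * I x
      = I x * (W (B.coord k) * I (B k)) - B.coord k x • I (B k) := fun k => by
    rw [mul_assoc, h.right_right, ← mul_assoc (I x), h.right_left, sub_mul, smul_mul_assoc,
      one_mul, mul_neg, mul_assoc]
    abel
  rw [ghostNumber, Finset.sum_mul, Finset.sum_congr rfl fun k _ => h1 k, Finset.sum_sub_distrib,
    sum_smul_right, ← Finset.mul_sum, mul_sub, mul_one]

lemma ghostNumber_mul_coad (x : L) :
    ghostNumber B W I * coad B W I x = coad B W I x * ghostNumber B W I := by
  rw [coad_apply, mul_neg, neg_mul, Finset.mul_sum, Finset.sum_mul]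
  congr 1
  refine Finset.sum_congr rfl fun k _ => ?_
  rw [← mul_assoc, h.ghostNumber_mul_left, mul_assoc, add_mul, one_mul, h.ghostNumber_mul_right,
    mul_assoc, mul_sub, mul_one, sub_add_cancel]

lemma ghostNumber_mul_ceDiff :
    ghostNumber B W I * ceDiff B W I = ceDiff B W I * (ghostNumber B W I + 1) := by
  rw [ceDiff, mul_smul_comm, smul_mul_assoc, Finset.mul_sum, Finset.sum_mul]
  congr 1
  refine Finset.sum_congr rfl fun k _ => ?_
  rw [← mul_assoc, h.ghostNumber_mul_left, mul_assoc, mul_assoc, mul_add (coad B W I (B k)),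
    add_mul, h.ghostNumber_mul_coad, one_mul, mul_one]

end IsGhostPair

end GhostAlgebra

/-! ### Root bases -/

section RootBasis

variable {L : Type*} [LieRing L] [LieAlgebra ℂ L] {T : Type*} [AddCommGroup T] [Module ℂ T]

/-- A choice of positive elements in a symmetric set `isRoot` of functionals. -/
structure IsPositiveChoice (isRoot : Module.Dual ℂ T → Prop) (P : Finset (Module.Dual ℂ T)) :
    Prop where
  isRoot_of_mem : ∀ α ∈ P, isRoot α
  neg_notMem : ∀ α ∈ P, -α ∉ P
  mem_or_neg_mem : ∀ α, isRoot α → α ∈ P ∨ -α ∈ P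
  add_mem : ∀ α ∈ P, ∀ β ∈ P, isRoot (α + β) → α + β ∈ P

/-- A root basis of a complex Lie algebra `L` with respect to an embedded abelian algebra `T`. This
is the part of the notion of a Chevalley basis that does not refer to a real form. -/
structure RootBasis (incl : T →ₗ[ℂ] L) (isRoot : Module.Dual ℂ T → Prop) (l : ℕ) where
  /-- The basis of `L` that consists of a basis of `T` and of root vectors. -/
  basis : Module.Basis (Fin l ⊕ {α // isRoot α}) ℂ L
  /-- The basis of `T`. -/
  cartanVec : Fin l → T
  /-- The coroots. -/
  coroot : Module.Dual ℂ T → T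
  basis_inl : ∀ i, basis (Sum.inl i) = incl (cartanVec i)
  ne_zero : ∀ α, isRoot α → α ≠ 0
  isRoot_neg : ∀ α, isRoot α → isRoot (-α)
  lie_incl : ∀ h h', ⁅incl h, incl h'⁆ = 0
  lie_basis : ∀ h (α : {α // isRoot α}),
    ⁅incl h, basis (Sum.inr α)⁆ = α.1 h • basis (Sum.inr α)
  lie_neg : ∀ α (hα : isRoot α),
    ⁅basis (Sum.inr ⟨α, hα⟩), basis (Sum.inr ⟨-α, isRoot_neg α hα⟩)⁆ = -incl (coroot α)
  apply_coroot : ∀ α, isRoot α → α (coroot α) = 2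
  lie_root : ∀ α β (hα : isRoot α) (hβ : isRoot β), α + β ≠ 0 →
    (∃ (hαβ : isRoot (α + β)) (N : ℂ), ⁅basis (Sum.inr ⟨α, hα⟩), basis (Sum.inr ⟨β, hβ⟩)⁆
        = N • basis (Sum.inr ⟨α + β, hαβ⟩)) ∨
      ⁅basis (Sum.inr ⟨α, hα⟩), basis (Sum.inr ⟨β, hβ⟩)⁆ = 0

namespace RootBasis

variable {incl : T →ₗ[ℂ] L} {isRoot : Module.Dual ℂ T → Prop} {l : ℕ}
  (R : RootBasis incl isRoot l)

open Classical in
/-- The root vector `τ_α` (zero if `α` is not a root). -/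
def vec (α : Module.Dual ℂ T) : L :=
  if hα : isRoot α then R.basis (Sum.inr ⟨α, hα⟩) else 0

open Classical in
/-- The form `θ^α` dual to `τ_α` (zero if `α` is not a root). -/
def form (α : Module.Dual ℂ T) : Module.Dual ℂ L :=
  if hα : isRoot α then R.basis.coord (Sum.inr ⟨α, hα⟩) else 0

lemma basis_inr (α : {α // isRoot α}) : R.basis (Sum.inr α) = R.vec α.1 := by
  simp [vec, α.2]

lemma coord_inr (α : {α // isRoot α}) : R.basis.coord (Sum.inr α) = R.form α.1 := by
  simp [form, α.2]

lemma vec_of_not {α : Module.Dual ℂ T} (hα : ¬isRoot α) : R.vec α = 0 := by simp [vec, hα]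

lemma form_of_not {α : Module.Dual ℂ T} (hα : ¬isRoot α) : R.form α = 0 := by simp [form, hα]

lemma form_vec_self {α : Module.Dual ℂ T} (hα : isRoot α) : R.form α (R.vec α) = 1 := by
  simp [form, vec, hα]

lemma form_vec_of_ne {α β : Module.Dual ℂ T} (h : α ≠ β) : R.form α (R.vec β) = 0 := by
  by_cases hα : isRoot α
  · by_cases hβ : isRoot β
    · simp [form, vec, hα, hβ, h.symm]
    · simp [R.vec_of_not hβ]
  · simp [R.form_of_not hα]

lemma form_cartanVec (α : Module.Dual ℂ T) (i : Fin l) :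
    R.form α (incl (R.cartanVec i)) = 0 := by
  by_cases hα : isRoot α
  · simp [form, hα, ← R.basis_inl]
  · simp [R.form_of_not hα]

lemma coord_inl_vec (α : Module.Dual ℂ T) (i : Fin l) :
    R.basis.coord (Sum.inl i) (R.vec α) = 0 := by
  by_cases hα : isRoot α
  · simp [vec, hα]
  · simp [R.vec_of_not hα]

lemma lie_vec (h : T) (α : Module.Dual ℂ T) : ⁅incl h, R.vec α⁆ = α h • R.vec α := by
  by_cases hα : isRoot α
  · simp only [vec, hα, dite_true, R.lie_basis]
  · simp [R.vec_of_not hα]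

lemma vec_lie (h : T) (α : Module.Dual ℂ T) : ⁅R.vec α, incl h⁆ = -(α h • R.vec α) := by
  rw [← lie_skew, lie_vec]

lemma vec_lie_neg {α : Module.Dual ℂ T} (hα : isRoot α) :
    ⁅R.vec α, R.vec (-α)⁆ = -incl (R.coroot α) := by
  simp only [vec, hα, R.isRoot_neg α hα, dite_true, R.lie_neg]

lemma vec_lie_vec (α β : Module.Dual ℂ T) (h : α + β ≠ 0) :
    ∃ N : ℂ, ⁅R.vec α, R.vec β⁆ = N • R.vec (α + β) := by
  by_cases hα : isRoot α
  · by_cases hβ : isRoot β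
    · rcases R.lie_root α β hα hβ h with ⟨hαβ, N, hN⟩ | h0
      · exact ⟨N, by simp only [vec, hα, hβ, hαβ, dite_true, hN]⟩
      · exact ⟨0, by simp only [vec, hα, hβ, dite_true, h0, zero_smul]⟩
    · exact ⟨0, by simp [R.vec_of_not hβ]⟩
  · exact ⟨0, by simp [R.vec_of_not hα]⟩

lemma form_lie_incl (α : Module.Dual ℂ T) (h : T) (x : L) :
    R.form α ⁅incl h, x⁆ = α h * R.form α x := by
  have : R.form α ∘ₗ (LieAlgebra.ad ℂ L (incl h) : Module.End ℂ L) = α h • R.form α := by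
    refine R.basis.ext fun k => ?_
    rcases k with i | β
    · simp [R.basis_inl, R.lie_incl, R.form_cartanVec]
    · simp only [R.basis_inr, LinearMap.comp_apply, LieAlgebra.ad_apply, R.lie_vec, map_smul,
        LinearMap.smul_apply]
      by_cases hαβ : α = β.1
      · rw [hαβ]
      · simp [R.form_vec_of_ne hαβ]
  exact LinearMap.congr_fun this x

lemma form_incl (α : Module.Dual ℂ T) (h : T) : R.form α (incl h) = 0 := by
  by_cases hα : isRoot α
  · obtain ⟨h', hh'⟩ : ∃ h', α h' ≠ 0 := by
      by_contra! hc
      exact R.ne_zero α hα (LinearMap.ext hc)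
    have := R.form_lie_incl α h' (incl h)
    rw [R.lie_incl, map_zero] at this
    exact (mul_eq_zero.mp this.symm).resolve_left hh'
  · simp [R.form_of_not hα]

lemma coroot_neg {α : Module.Dual ℂ T} (hα : isRoot α) :
    incl (R.coroot (-α)) = -incl (R.coroot α) := by
  have h := R.vec_lie_neg (R.isRoot_neg α hα)
  rw [neg_neg, ← lie_skew, R.vec_lie_neg hα, neg_neg] at h
  rw [h, neg_neg]

variable [Fintype {α // isRoot α}]

lemma sum_coord_inl (h : T) :
    ∑ i, R.basis.coord (Sum.inl i) (incl h) • incl (R.cartanVec i) = incl h := by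
  have h1 := R.basis.sum_repr (incl h)
  rw [Fintype.sum_sum_type] at h1
  simp only [← Module.Basis.coord_apply, R.coord_inr, R.form_incl, R.basis_inl, zero_smul,
    Finset.sum_const_zero, add_zero] at h1
  exact h1

/-- A sum over the roots is a sum over the positive roots and their opposites. -/
lemma sum_roots (R : RootBasis incl isRoot l) {P : Finset (Module.Dual ℂ T)}
    (hP : IsPositiveChoice isRoot P) {N : Type*} [AddCommMonoid N] (g : Module.Dual ℂ T → N) :
    ∑ β : {α // isRoot α}, g β.1 = ∑ α ∈ P, g α + ∑ α ∈ P, g (-α) := by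
  classical
  have h1 : ∑ α ∈ P, g (-α) = ∑ α ∈ P.image Neg.neg, g α := by
    rw [Finset.sum_image fun x _ y _ hxy => neg_injective hxy]
  have hd : Disjoint P (P.image Neg.neg) := by
    rw [Finset.disjoint_left]
    intro a ha hb
    obtain ⟨b, hb', rfl⟩ := Finset.mem_image.mp hb
    exact hP.neg_notMem b hb' ha
  rw [h1, ← Finset.sum_union hd]
  refine Finset.sum_bij (fun β _ => β.1) (fun β _ => ?_) (fun _ _ _ _ h => Subtype.ext h)
    (fun β hβ => ?_) (fun _ _ => rfl)
  · rcases hP.mem_or_neg_mem β.1 β.2 with h | h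
    · exact Finset.mem_union_left _ h
    · exact Finset.mem_union_right _ (Finset.mem_image.mpr ⟨_, h, neg_neg _⟩)
  · refine ⟨⟨β, ?_⟩, Finset.mem_univ _, rfl⟩
    rcases Finset.mem_union.mp hβ with h | h
    · exact hP.isRoot_of_mem β h
    · obtain ⟨b, hb, rfl⟩ := Finset.mem_image.mp h
      exact R.isRoot_neg b (hP.isRoot_of_mem b hb)

end RootBasis

end RootBasis

/-! ### Positivity of `2ϱ` on the positive coroots -/

section Positivity

variable {L : Type*} [LieRing L] [LieAlgebra ℂ L] {T : Type*} [AddCommGroup T] [Module ℂ T]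
  {incl : T →ₗ[ℂ] L} {isRoot : Module.Dual ℂ T → Prop} {l : ℕ}
  (R : RootBasis incl isRoot l)

namespace RootBasis

/-- The coefficient `a` in `[τ_{-α}, [τ_α, τ_γ]] = -a τ_γ`. -/
def stringCoeff (α γ : Module.Dual ℂ T) : ℂ := -R.form γ ⁅R.vec (-α), ⁅R.vec α, R.vec γ⁆⁆

lemma lie_neg_lie {α γ : Module.Dual ℂ T} (hγ : γ ≠ 0) (h : α + γ ≠ 0) :
    ⁅R.vec (-α), ⁅R.vec α, R.vec γ⁆⁆ = -R.stringCoeff α γ • R.vec γ := by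
  by_cases hr : isRoot γ
  · obtain ⟨N, hN⟩ := R.vec_lie_vec α γ h
    obtain ⟨M, hM⟩ := R.vec_lie_vec (-α) (α + γ) (by simpa using hγ)
    rw [neg_add_cancel_left] at hM
    simp [stringCoeff, hN, hM, R.form_vec_self hr, smul_smul]
  · simp [R.vec_of_not hr]

lemma lie_lie_neg {α γ : Module.Dual ℂ T} (hγ : γ ≠ 0) (h : α ≠ γ) :
    ⁅R.vec α, ⁅R.vec (-α), R.vec γ⁆⁆ = -R.stringCoeff α (γ - α) • R.vec γ := by
  have h' : -α + γ ≠ 0 := by rw [neg_add_eq_sub, sub_ne_zero]; exact h.symm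
  obtain ⟨N, hN⟩ := R.vec_lie_vec (-α) γ h'
  rw [neg_add_eq_sub] at hN h'
  by_cases hr : isRoot (γ - α)
  · obtain ⟨M, hM⟩ := R.vec_lie_vec α (γ - α) (by simpa using hγ)
    rw [add_sub_cancel] at hM
    have : R.stringCoeff α (γ - α) = -(M * N) := by
      simp [stringCoeff, hM, hN, R.form_vec_self hr]
    rw [hN, lie_smul, hM, this, neg_neg, smul_smul, mul_comm]
  · simp [hN, R.vec_of_not hr, stringCoeff]

/-- On the root vector `τ_β`, the coroot `H_α = -[τ_α, τ_{-α}]` acts by the difference of two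
consecutive string coefficients. -/
lemma apply_coroot_eq_sub {α β : Module.Dual ℂ T} (hα : isRoot α) (hβ : isRoot β) (h : α ≠ β)
    (h' : α + β ≠ 0) :
    β (R.coroot α) = R.stringCoeff α (β - α) - R.stringCoeff α β := by
  have h1 : ⁅⁅R.vec α, R.vec (-α)⁆, R.vec β⁆ = -(β (R.coroot α) • R.vec β) := by
    rw [R.vec_lie_neg hα, neg_lie, R.lie_vec]
  rw [lie_lie, R.lie_lie_neg (R.ne_zero β hβ) h, R.lie_neg_lie (R.ne_zero β hβ) h'] at h1
  have h2 := congrArg (R.form β) h1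
  simp only [map_sub, map_neg, map_smul, smul_eq_mul, R.form_vec_self hβ, mul_one] at h2
  linear_combination h2

/-- The string coefficients of a compact form are non-negative: `a κ(τ_γ, τ̄_γ)` is the value at
`[τ_α, τ_γ]` of the definite Hermitian form `κ(x, x̄)`. -/
lemma stringCoeff_nonneg (κ : L →ₗ[ℂ] L →ₗ[ℂ] ℂ) (cj : L → L)
    (hinv : ∀ x y z : L, κ ⁅x, y⁆ z = -κ y ⁅x, z⁆)
    (hlie : ∀ x y : L, cj ⁅x, y⁆ = ⁅cj x, cj y⁆) (hcj : ∀ α, isRoot α → cj (R.vec α) = R.vec (-α))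
    (hneg : ∀ x, x ≠ 0 → ∃ r : ℝ, r < 0 ∧ κ x (cj x) = r)
    {α γ : Module.Dual ℂ T} (hα : isRoot α) (h : α + γ ≠ 0) :
    ∃ r : ℝ, 0 ≤ r ∧ R.stringCoeff α γ = r := by
  by_cases hγ : isRoot γ
  · by_cases h0 : ⁅R.vec α, R.vec γ⁆ = 0
    · exact ⟨0, le_rfl, by simp [stringCoeff, h0]⟩
    · have hv : R.vec γ ≠ 0 := fun hv => by
        have := R.form_vec_self hγ
        simp [hv] at this
      obtain ⟨r, hr, hr'⟩ := hneg _ h0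
      obtain ⟨s, hs, hs'⟩ := hneg _ hv
      refine ⟨r / s, div_nonneg_of_nonpos hr.le hs.le, ?_⟩
      have h1 : κ ⁅R.vec (-α), ⁅R.vec α, R.vec γ⁆⁆ (cj (R.vec γ)) = -(r : ℂ) := by
        rw [hinv, ← hcj α hα, ← hlie, hr']
      rw [R.lie_neg_lie (R.ne_zero γ hγ) h, map_smul, LinearMap.smul_apply, hs', smul_eq_mul] at h1
      have hs0 : (s : ℂ) ≠ 0 := by exact_mod_cast hs.ne
      push_cast
      rw [eq_div_iff hs0]
      linear_combination -h1
  · exact ⟨0, le_rfl, by simp [stringCoeff, R.vec_of_not hγ]⟩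

/-- `⟨2ϱ, H_α⟩ ≥ 0` for a positive root `α`, which need not be simple. The telescoping sum of the
differences of string coefficients reduces to the non-negative coefficients at the lower ends. -/
lemma sum_apply_coroot_nonneg {P : Finset (Module.Dual ℂ T)} (hP : IsPositiveChoice isRoot P)
    {α : Module.Dual ℂ T} (hα : α ∈ P)
    (hnn : ∀ γ, α + γ ≠ 0 → ∃ r : ℝ, 0 ≤ r ∧ R.stringCoeff α γ = r) :
    ∃ s : ℝ, 0 ≤ s ∧ ∑ β ∈ P, β (R.coroot α) = s := by
  classical
  have hrα := hP.isRoot_of_mem α hα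
  set a : Module.Dual ℂ T → ℝ := fun γ => (R.stringCoeff α γ).re with ha
  have ha' : ∀ γ, α + γ ≠ 0 → 0 ≤ a γ ∧ R.stringCoeff α γ = a γ := fun γ hγ => by
    obtain ⟨r, hr, hr'⟩ := hnn γ hγ
    simp [ha, hr', hr]
  have hne : ∀ β ∈ P, α + β ≠ 0 := fun β hβ h => by
    rw [add_comm, add_eq_zero_iff_eq_neg] at h
    exact hP.neg_notMem α hα (h ▸ hβ)
  have hne' : ∀ β ∈ P, α + (β - α) ≠ 0 := fun β hβ => by
    rw [add_sub_cancel]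
    exact R.ne_zero β (hP.isRoot_of_mem β hβ)
  have hterm : ∀ β ∈ P.erase α, β (R.coroot α) = ((a (β - α) - a β : ℝ) : ℂ) := fun β hβ => by
    obtain ⟨hβα, hβ⟩ := Finset.mem_erase.mp hβ
    rw [R.apply_coroot_eq_sub hrα (hP.isRoot_of_mem β hβ) hβα.symm (hne β hβ),
      (ha' _ (hne β hβ)).2, (ha' _ (hne' β hβ)).2]
    push_cast; rfl
  have hshift : ∀ β ∈ P.erase α, a β ≠ 0 → β + α ∈ P.erase α := fun β hβ h0 => by
    obtain ⟨hβα, hβ⟩ := Finset.mem_erase.mp hβ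
    have hr : isRoot (α + β) := by
      by_contra hr
      obtain ⟨N, hN⟩ := R.vec_lie_vec α β (hne β hβ)
      apply h0
      simp [ha, stringCoeff, hN, R.vec_of_not hr]
    rw [add_comm]
    exact Finset.mem_erase.mpr ⟨fun h => R.ne_zero β (hP.isRoot_of_mem β hβ) (by simpa using h),
      hP.add_mem α hα β hβ hr⟩
  have hle : ∑ β ∈ P.erase α, a β ≤ ∑ β ∈ P.erase α, a (β - α) := by
    rw [← Finset.sum_filter_ne_zero]
    have h1 : ∑ β ∈ (P.erase α).filter (fun β => a β ≠ 0), a β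
        = ∑ γ ∈ ((P.erase α).filter (fun β => a β ≠ 0)).image (· + α), a (γ - α) := by
      rw [Finset.sum_image fun x _ y _ hxy => add_right_cancel hxy]
      simp
    rw [h1]
    refine Finset.sum_le_sum_of_subset_of_nonneg ?_ fun β hβ _ =>
      (ha' _ (hne' β (Finset.mem_of_mem_erase hβ))).1
    intro γ hγ
    obtain ⟨β, hβ, rfl⟩ := Finset.mem_image.mp hγ
    obtain ⟨hβ, h0⟩ := Finset.mem_filter.mp hβ
    exact hshift β hβ h0
  refine ⟨2 + ∑ β ∈ P.erase α, (a (β - α) - a β), ?_, ?_⟩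
  · rw [Finset.sum_sub_distrib]
    linarith
  · rw [← Finset.add_sum_erase P _ hα, R.apply_coroot α hrα, Finset.sum_congr rfl hterm]
    push_cast; rfl

end RootBasis

end Positivity

/-! ### The anomaly and the Lefschetz relation -/

section AnomalousDifferential

variable {L : Type*} [LieRing L] [LieAlgebra ℂ L] {A : Type*} [Ring A] [Algebra ℂ A]

/-- Ghosts `W`, anti-ghosts `I` and a representation `ρ` of `L` in an algebra `A`, where the
representation commutes with the ghosts and the anti-ghosts. -/
structure IsGhostRep (W : Module.Dual ℂ L →ₗ[ℂ] A) (I : L →ₗ[ℂ] A) (ρ : L →ₗ[ℂ] A) : Prop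
    extends IsGhostPair W I where
  rep_mul_rep : ∀ x y, ρ x * ρ y = ρ y * ρ x + ρ ⁅x, y⁆
  rep_mul_left : ∀ x θ, ρ x * W θ = W θ * ρ x
  rep_mul_right : ∀ x y, ρ x * I y = I y * ρ x

variable {T : Type*} [AddCommGroup T] [Module ℂ T]
  {incl : T →ₗ[ℂ] L} {isRoot : Module.Dual ℂ T → Prop} {l : ℕ}

namespace RootBasis

variable (R : RootBasis incl isRoot l) (W : Module.Dual ℂ L →ₗ[ℂ] A) (I : L →ₗ[ℂ] A)
  (P : Finset (Module.Dual ℂ T)) (χ : Module.Dual ℂ L) (ρ : L →ₗ[ℂ] A)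

/-- The ghost `c^α`, multiplication by `θ^{-α}`. -/
def ghost (α : Module.Dual ℂ T) : A := W (R.form (-α))

/-- The anti-ghost `b_α`, substitution of `τ_α`. -/
def antighost (α : Module.Dual ℂ T) : A := I (R.vec α)

/-- The normally ordered action of `T` on the ghost sector. -/
def cartanGhost (h : T) : A :=
  (-1 : ℂ) • (∑ β ∈ P, β h • (R.ghost W (-β) * R.antighost I β)
    + ∑ β ∈ P, β h • (R.antighost I (-β) * R.ghost W β))

/-- The relative ghost number `∑_{α>0} (c^{-α} b_α - b_{-α} c^α)`. -/
def relNumber : A :=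
  ∑ α ∈ P, R.ghost W (-α) * R.antighost I α - ∑ α ∈ P, R.antighost I (-α) * R.ghost W α

/-- The one-form on `L` that vanishes on the root vectors and equals `2ϱ` on `T`. -/
def twoRho : Module.Dual ℂ L :=
  ∑ i, (∑ β ∈ P, β (R.cartanVec i)) • R.basis.coord (Sum.inl i)

/-- The Kähler form `∑_{α>0} ⟨χ + 2ϱ, H_α⟩ θ^α ∧ θ^{-α}`, as an operator. -/
def kaehler : A :=
  ∑ α ∈ P, (χ + R.twoRho P) (incl (R.coroot α)) • (R.ghost W (-α) * R.ghost W α)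

/-- The operator dual to multiplication by the Kähler form. -/
def dualKaehler : A :=
  ∑ α ∈ P, ((χ + R.twoRho P) (incl (R.coroot α)))⁻¹ • (R.antighost I (-α) * R.antighost I α)

/-- The shifted operators `ρ(x) - ⟨χ, x⟩`. -/
def shifted (x : L) : A := ρ x - χ x • (1 : A)

/-- The total action of `T`. -/
def cartanTotal (h : T) : A := shifted χ ρ (incl h) + R.cartanGhost W I P h

variable {P}

lemma twoRho_vec (α : Module.Dual ℂ T) : R.twoRho P (R.vec α) = 0 := by
  simp only [twoRho, LinearMap.sum_apply, LinearMap.smul_apply, R.coord_inl_vec, smul_zero,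
    Finset.sum_const_zero]

lemma compAd_form_neg (α : Module.Dual ℂ T) (hα : isRoot α) :
    compAd (R.form (-α)) (R.vec (-α))
      = ∑ i, α (R.cartanVec i) • R.basis.coord (Sum.inl i) := by
  classical
  refine R.basis.ext fun k => ?_
  rcases k with j | γ
  · rw [compAd_apply, R.basis_inl, R.vec_lie, map_neg, map_smul,
      R.form_vec_self (R.isRoot_neg α hα), LinearMap.sum_apply, ← R.basis_inl]
    simp [Finsupp.single_apply]
  · rw [compAd_apply, R.basis_inr, LinearMap.sum_apply]
    simp only [LinearMap.smul_apply, R.coord_inl_vec, smul_zero, Finset.sum_const_zero]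
    by_cases h : -α + γ.1 = 0
    · have : R.vec γ.1 = R.vec (- -α) := by rw [eq_neg_of_add_eq_zero_right h]
      rw [this, R.vec_lie_neg (R.isRoot_neg α hα), map_neg, R.form_incl, neg_zero]
    · obtain ⟨N, hN⟩ := R.vec_lie_vec _ _ h
      rw [hN, map_smul, R.form_vec_of_ne, smul_zero]
      intro h'
      exact R.ne_zero γ.1 γ.2 (by simpa using h')

lemma compAd_cartanVec (lam : Module.Dual ℂ L) (hlam : ∀ α, lam (R.vec α) = 0) (h : T) :
    compAd lam (incl h) = 0 := by
  refine R.basis.ext fun k => ?_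
  rcases k with j | γ
  · simp [R.basis_inl, R.lie_incl]
  · simp [R.basis_inr, R.lie_vec, hlam]

lemma compAd_vec (lam : Module.Dual ℂ L) (hlam : ∀ α, lam (R.vec α) = 0)
    {α : Module.Dual ℂ T} (hα : isRoot α) :
    compAd lam (R.vec α) = -lam (incl (R.coroot α)) • R.form (-α) := by
  refine R.basis.ext fun k => ?_
  rcases k with j | γ
  · simp [R.basis_inl, R.vec_lie, hlam, R.form_cartanVec]
  · rw [compAd_apply, R.basis_inr, LinearMap.smul_apply]
    by_cases h : α + γ.1 = 0
    · rw [eq_neg_of_add_eq_zero_right h, R.vec_lie_neg hα, R.form_vec_self (R.isRoot_neg α hα)]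
      simp
    · obtain ⟨N, hN⟩ := R.vec_lie_vec _ _ h
      rw [hN, map_smul, hlam, R.form_vec_of_ne, smul_zero, smul_zero]
      rintro h'
      exact h (by rw [← h', add_neg_cancel])

lemma lie_antighost (h : T) (α : Module.Dual ℂ T) :
    I ⁅incl h, R.vec α⁆ = α h • R.antighost I α := by
  rw [R.lie_vec, map_smul, antighost]

variable [Fintype {α // isRoot α}]

lemma sum_coord_mul_apply {β : Module.Dual ℂ T} (hβ : isRoot β) (h : T) :
    ∑ i, R.basis.coord (Sum.inl i) (incl h) * β (R.cartanVec i) = β h := by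
  have h1 : ∀ h', β h' = R.form β ⁅incl h', R.vec β⁆ := fun h' => by
    rw [R.lie_vec, map_smul, R.form_vec_self hβ, smul_eq_mul, mul_one]
  have h2 : ⁅incl h, R.vec β⁆
      = ∑ i, R.basis.coord (Sum.inl i) (incl h) • ⁅incl (R.cartanVec i), R.vec β⁆ := by
    conv_lhs => rw [← R.sum_coord_inl h]
    rw [sum_lie]
    simp only [smul_lie]
  rw [h1 h, h2, map_sum]
  refine Finset.sum_congr rfl fun i _ => ?_
  rw [map_smul, h1, smul_eq_mul]

lemma twoRho_incl (hP : IsPositiveChoice isRoot P) (h : T) :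
    R.twoRho P (incl h) = ∑ β ∈ P, β h := by
  simp only [twoRho, LinearMap.sum_apply, LinearMap.smul_apply, smul_eq_mul, Finset.sum_mul]
  rw [Finset.sum_comm]
  refine Finset.sum_congr rfl fun β hβ => ?_
  rw [← R.sum_coord_mul_apply (hP.isRoot_of_mem β hβ) h]
  exact Finset.sum_congr rfl fun i _ => mul_comm _ _

variable (P) in
/-- The normally ordered ghost differential. -/
def normalDiff : A :=
  (1 / 2 : ℂ) • ∑ α ∈ P, R.ghost W (-α) * coad R.basis W I (R.vec α)
    + (1 / 2 : ℂ) • ∑ α ∈ P, coad R.basis W I (R.vec (-α)) * R.ghost W α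
    + (1 / 2 : ℂ) • ∑ i, W (R.basis.coord (Sum.inl i)) * R.cartanGhost W I P (R.cartanVec i)

variable (P) in
/-- The total anomalous differential. -/
def totalDiff : A :=
  ∑ α ∈ P, (R.ghost W (-α) * shifted χ ρ (R.vec α) + R.ghost W α * shifted χ ρ (R.vec (-α)))
    + ∑ i, W (R.basis.coord (Sum.inl i)) * shifted χ ρ (incl (R.cartanVec i))
    + R.normalDiff W I P

omit [Algebra ℂ A] in
/-- A sum over the basis is a sum over the basis of `T`, the positive and the negative roots. -/
lemma sum_basis (hP : IsPositiveChoice isRoot P) (f : Module.Dual ℂ L → L → A) :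
    ∑ k, f (R.basis.coord k) (R.basis k)
      = ∑ i, f (R.basis.coord (Sum.inl i)) (incl (R.cartanVec i))
        + (∑ α ∈ P, f (R.form α) (R.vec α) + ∑ α ∈ P, f (R.form (-α)) (R.vec (-α))) := by
  rw [Fintype.sum_sum_type]
  simp only [R.basis_inl, R.basis_inr, R.coord_inr]
  rw [R.sum_roots hP fun α => f (R.form α) (R.vec α)]

variable {W I} (hG : IsGhostPair W I) (hP : IsPositiveChoice isRoot P)

include hG hP

omit [Fintype {α // isRoot α}] in
lemma antighost_mul_ghost_neg {α : Module.Dual ℂ T} (hα : α ∈ P) :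
    R.antighost I (-α) * R.ghost W α = 1 - R.ghost W α * R.antighost I (-α) := by
  rw [antighost, ghost, hG.right_left,
    R.form_vec_self (R.isRoot_neg α (hP.isRoot_of_mem α hα)), one_smul]

/-- The normally ordered action of `T` differs from the coadjoint action by `2ϱ`. -/
lemma coad_incl (h : T) :
    coad R.basis W I (incl h)
      = R.cartanGhost W I P h + R.twoRho P (incl h) • (1 : A) := by
  have h1 : ∀ β ∈ P, β h • (R.antighost I (-β) * R.ghost W β)
      = β h • (1 : A) + (-β) h • (W (R.form (-β)) * I (R.vec (-β))) := fun β hβ => by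
    rw [R.antighost_mul_ghost_neg hG hP hβ, smul_sub, LinearMap.neg_apply, neg_smul, ghost,
      antighost]
    abel
  rw [coad_apply, R.sum_basis hP (fun θ x => W θ * I ⁅incl h, x⁆)]
  simp only [R.lie_incl, map_zero, mul_zero, Finset.sum_const_zero, zero_add, R.lie_vec, map_smul,
    mul_smul_comm]
  rw [cartanGhost, Finset.sum_congr rfl h1, Finset.sum_add_distrib, ← Finset.sum_smul,
    R.twoRho_incl hP]
  simp only [ghost, antighost, neg_neg]
  module

lemma normalDiff_eq : R.normalDiff W I P = ceDiff R.basis W I - W (R.twoRho P) := by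
  have h1 : ∀ α ∈ P, coad R.basis W I (R.vec (-α)) * R.ghost W α
      = W (R.form (-α)) * coad R.basis W I (R.vec (-α))
        - ∑ i, α (R.cartanVec i) • W (R.basis.coord (Sum.inl i)) := fun α hα => by
    rw [ghost, hG.coad_mul_left, R.compAd_form_neg α (hP.isRoot_of_mem α hα), map_sum]
    simp only [map_smul]
  have h2 : ∀ i, W (R.basis.coord (Sum.inl i)) * R.cartanGhost W I P (R.cartanVec i)
      = W (R.basis.coord (Sum.inl i)) * coad R.basis W I (incl (R.cartanVec i))
        - (∑ β ∈ P, β (R.cartanVec i)) • W (R.basis.coord (Sum.inl i)) := fun i => by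
    rw [R.coad_incl hG hP, mul_add, mul_smul_comm, mul_one, R.twoRho_incl hP, add_sub_cancel_right]
  have h3 : ∑ α ∈ P, ∑ i, α (R.cartanVec i) • W (R.basis.coord (Sum.inl i))
      = W (R.twoRho P) := by
    rw [Finset.sum_comm, twoRho, map_sum]
    simp only [map_smul, ← Finset.sum_smul]
  have h4 : ∑ i, (∑ β ∈ P, β (R.cartanVec i)) • W (R.basis.coord (Sum.inl i))
      = W (R.twoRho P) := by
    rw [twoRho, map_sum]
    simp only [map_smul]
  rw [normalDiff, ceDiff, R.sum_basis hP (fun θ x => W θ * coad R.basis W I x),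
    Finset.sum_congr rfl h1, Finset.sum_congr rfl fun i _ => h2 i, Finset.sum_sub_distrib,
    Finset.sum_sub_distrib, h3, h4]
  simp only [ghost, neg_neg]
  module

/-- The anomalous differential is the Chevalley–Eilenberg differential with coefficients in the
representation, minus multiplication by the one-form `χ + 2ϱ`. -/
lemma totalDiff_eq :
    R.totalDiff W I P χ ρ
      = ∑ k, W (R.basis.coord k) * ρ (R.basis k) + ceDiff R.basis W I
        - W (χ + R.twoRho P) := by
  have h1 : ∑ k, χ (R.basis k) • W (R.basis.coord k) = W χ := sum_smul_left R.basis W χ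
  have h2 : ∑ k, W (R.basis.coord k) * shifted χ ρ (R.basis k)
      = ∑ k, W (R.basis.coord k) * ρ (R.basis k) - W χ := by
    simp only [shifted, mul_sub, mul_smul_comm, mul_one, Finset.sum_sub_distrib, h1]
  have h3 := R.sum_basis hP (fun θ x => W θ * shifted χ ρ x)
  rw [h2] at h3
  rw [totalDiff, R.normalDiff_eq hG hP, map_add, Finset.sum_add_distrib]
  simp only [ghost, neg_neg]
  rw [add_comm (∑ α ∈ P, _ + ∑ α ∈ P, _) (∑ i, _), ← h3]
  abel

variable {ρ} {χ}

omit hG in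
/-- The anomaly: the square of the total differential is minus multiplication by the Kähler
form. -/
lemma totalDiff_mul_self (hGR : IsGhostRep W I ρ) (hχ : ∀ α, χ (R.vec α) = 0) :
    R.totalDiff W I P χ ρ * R.totalDiff W I P χ ρ = -R.kaehler W P χ := by
  have hG := hGR.toIsGhostPair
  set lam := χ + R.twoRho P with hlam
  have hlam0 : ∀ α, lam (R.vec α) = 0 := fun α => by
    rw [hlam, LinearMap.add_apply, hχ, R.twoRho_vec, add_zero]
  set D₀ := ∑ k, W (R.basis.coord k) * ρ (R.basis k) + ceDiff R.basis W I with hD₀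
  have hsq : D₀ * D₀ = 0 :=
    hG.sum_add_ceDiff_mul_self R.basis ρ hGR.rep_mul_rep hGR.rep_mul_left hGR.rep_mul_right
  have hcomm : D₀ * W lam = -(W lam * D₀)
      - (1 / 2 : ℂ) • ∑ k, W (R.basis.coord k) * W (compAd lam (R.basis k)) := by
    rw [hD₀, add_mul, hG.ceDiff_mul_left, mul_add, Finset.sum_mul, Finset.mul_sum]
    have : ∀ k, W (R.basis.coord k) * ρ (R.basis k) * W lam
        = -(W lam * (W (R.basis.coord k) * ρ (R.basis k))) := fun k => by
      rw [mul_assoc, hGR.rep_mul_left, ← mul_assoc, hG.left_left, neg_mul, mul_assoc]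
    rw [Finset.sum_congr rfl fun k _ => this k, Finset.sum_neg_distrib]
    abel
  have hsum : ∑ k, W (R.basis.coord k) * W (compAd lam (R.basis k))
      = (-2 : ℂ) • R.kaehler W P χ := by
    rw [R.sum_basis hP (fun θ x => W θ * W (compAd lam x)), kaehler, Finset.smul_sum]
    simp only [R.compAd_cartanVec lam hlam0, map_zero, mul_zero, Finset.sum_const_zero, zero_add]
    rw [← Finset.sum_add_distrib]
    refine Finset.sum_congr rfl fun α hα => ?_
    have hr := hP.isRoot_of_mem α hα
    rw [R.compAd_vec lam hlam0 hr, R.compAd_vec lam hlam0 (R.isRoot_neg α hr),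
      R.coroot_neg hr, hG.left_left (R.form (-α))]
    simp only [ghost, neg_neg, map_neg, map_smul, neg_smul, mul_neg, smul_mul_assoc,
      mul_smul_comm]
    module
  rw [R.totalDiff_eq χ ρ hG hP, ← hlam, ← hD₀, sub_mul, mul_sub, mul_sub, hsq, hcomm,
    hG.mul_self_left, hsum]
  module

omit hG in
/-- The anticommutator of the total differential and the substitution of `h` is the total action
of `h`. -/
lemma totalDiff_mul_incl (hGR : IsGhostRep W I ρ) (h : T) :
    R.totalDiff W I P χ ρ * I (incl h)
      = R.cartanTotal W I P χ ρ h - I (incl h) * R.totalDiff W I P χ ρ := by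
  have hG := hGR.toIsGhostPair
  have h1 : (∑ k, W (R.basis.coord k) * ρ (R.basis k)) * I (incl h)
      = ρ (incl h) - I (incl h) * ∑ k, W (R.basis.coord k) * ρ (R.basis k) := by
    have : ∀ k, W (R.basis.coord k) * ρ (R.basis k) * I (incl h)
        = R.basis.coord k (incl h) • ρ (R.basis k)
          - I (incl h) * (W (R.basis.coord k) * ρ (R.basis k)) := fun k => by
      rw [mul_assoc, hGR.rep_mul_right, ← mul_assoc, ← mul_assoc, hG.right_left, sub_mul,
        smul_mul_assoc, one_mul]
      abel
    rw [Finset.sum_mul, Finset.sum_congr rfl fun k _ => this k, Finset.sum_sub_distrib,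
      sum_smul_right R.basis ρ, Finset.mul_sum]
  rw [R.totalDiff_eq χ ρ hG hP, sub_mul, add_mul, h1, hG.ceDiff_mul_right, R.coad_incl hG hP,
    mul_sub, mul_add, hG.right_left, cartanTotal, shifted, LinearMap.add_apply]
  module

omit [Fintype {α // isRoot α}] hP in
lemma kaehler_mul_incl (h : T) :
    R.kaehler W P χ * I (incl h) = I (incl h) * R.kaehler W P χ := by
  have hc : ∀ α, R.ghost W α * I (incl h) = -(I (incl h) * R.ghost W α) := fun α => by
    rw [ghost, hG.right_left, R.form_incl, zero_smul, zero_sub, neg_neg]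
  rw [kaehler, Finset.sum_mul, Finset.mul_sum]
  refine Finset.sum_congr rfl fun α _ => ?_
  rw [smul_mul_assoc, mul_smul_comm, mul_assoc, hc, mul_neg, ← mul_assoc, hc, neg_mul, neg_neg,
    mul_assoc]

omit hG in
lemma cartanTotal_mul_totalDiff (hGR : IsGhostRep W I ρ) (hχ : ∀ α, χ (R.vec α) = 0) (h : T) :
    R.cartanTotal W I P χ ρ h * R.totalDiff W I P χ ρ
      = R.totalDiff W I P χ ρ * R.cartanTotal W I P χ ρ h := by
  have h1 : R.cartanTotal W I P χ ρ h
      = R.totalDiff W I P χ ρ * I (incl h) + I (incl h) * R.totalDiff W I P χ ρ := by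
    rw [R.totalDiff_mul_incl hP hGR, sub_add_cancel]
  have h2 := R.totalDiff_mul_self hP hGR hχ
  have h3 := R.kaehler_mul_incl (χ := χ) (P := P) hGR.toIsGhostPair h
  rw [h1, add_mul, mul_add, mul_assoc, mul_assoc, h2, ← mul_assoc (R.totalDiff W I P χ ρ) _ (I _),
    h2, mul_neg, neg_mul, h3, add_comm]

omit hG in
lemma cartanTotal_mul_dualKaehler (hGR : IsGhostRep W I ρ) (h : T) :
    R.cartanTotal W I P χ ρ h * R.dualKaehler I P χ
      = R.dualKaehler I P χ * R.cartanTotal W I P χ ρ h := by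
  have hG := hGR.toIsGhostPair
  have hc : ∀ α, coad R.basis W I (incl h) * R.antighost I α
      = R.antighost I α * coad R.basis W I (incl h) + α h • R.antighost I α := fun α => by
    rw [antighost, hG.coad_mul_right, R.lie_antighost, antighost]
  have h1 : coad R.basis W I (incl h) * R.dualKaehler I P χ
      = R.dualKaehler I P χ * coad R.basis W I (incl h) := by
    rw [dualKaehler, Finset.mul_sum, Finset.sum_mul]
    refine Finset.sum_congr rfl fun α _ => ?_
    rw [smul_mul_assoc, mul_smul_comm, ← mul_assoc, hc, add_mul, mul_assoc, hc, mul_add, mul_assoc,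
      LinearMap.neg_apply, neg_smul, neg_mul, smul_mul_assoc, mul_smul_comm, add_neg_cancel_right]
  have h2 : ρ (incl h) * R.dualKaehler I P χ = R.dualKaehler I P χ * ρ (incl h) := by
    rw [dualKaehler, Finset.mul_sum, Finset.sum_mul]
    refine Finset.sum_congr rfl fun α _ => ?_
    rw [smul_mul_assoc, mul_smul_comm, antighost, antighost, ← mul_assoc, hGR.rep_mul_right,
      mul_assoc, hGR.rep_mul_right, mul_assoc]
  have h3 : R.cartanGhost W I P h
      = coad R.basis W I (incl h) - R.twoRho P (incl h) • (1 : A) := by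
    rw [R.coad_incl hG hP, add_sub_cancel_right]
  rw [cartanTotal, shifted, h3]
  simp only [add_mul, sub_mul, mul_add, mul_sub, h1, h2, smul_mul_assoc, mul_smul_comm, one_mul,
    mul_one]

omit [Fintype {α // isRoot α}] hG hP in
lemma incl_mul_dualKaehler (hG : IsGhostPair W I) (x : L) :
    I x * R.dualKaehler I P χ = R.dualKaehler I P χ * I x := by
  rw [dualKaehler, Finset.mul_sum, Finset.sum_mul]
  refine Finset.sum_congr rfl fun α _ => ?_
  rw [smul_mul_assoc, mul_smul_comm, antighost, antighost, ← mul_assoc, hG.right_right x,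
    neg_mul, mul_assoc, hG.right_right x, mul_neg, neg_neg, mul_assoc]

omit [Fintype {α // isRoot α}] in
/-- The Lefschetz relation: multiplication by the Kähler form and its dual commute to the relative
ghost number. -/
lemma kaehler_mul_dualKaehler
    (hne : ∀ α ∈ P, (χ + R.twoRho P) (incl (R.coroot α)) ≠ 0) :
    R.kaehler W P χ * R.dualKaehler I P χ
      = R.dualKaehler I P χ * R.kaehler W P χ + R.relNumber W I P := by
  classical
  have hne0 : ∀ α ∈ P, ∀ β ∈ P, α ≠ -β := fun α hα β hβ h => hP.neg_notMem β hβ (h ▸ hα)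
  have hcb : ∀ α β, α ≠ -β → R.ghost W α * R.antighost I β = -(R.antighost I β * R.ghost W α) :=
    fun α β h => by
      rw [antighost, ghost, hG.right_left, R.form_vec_of_ne fun h' => h (by rw [← h', neg_neg]),
        zero_smul, zero_sub, neg_neg]
  have hcb' : ∀ β ∈ P, R.ghost W (-β) * R.antighost I β
      = 1 - R.antighost I β * R.ghost W (-β) := fun β hβ => by
    rw [antighost, ghost, neg_neg, hG.right_left, R.form_vec_self (hP.isRoot_of_mem β hβ),
      one_smul, sub_sub_cancel]
  have hcb'' : ∀ β ∈ P, R.ghost W β * R.antighost I (-β)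
      = 1 - R.antighost I (-β) * R.ghost W β := fun β hβ => by
    rw [R.antighost_mul_ghost_neg hG hP hβ, sub_sub_cancel]
  -- The commutators of the Kähler form with the single anti-ghosts.
  have h1 : ∀ β ∈ P, R.kaehler W P χ * R.antighost I β = R.antighost I β * R.kaehler W P χ
      - (χ + R.twoRho P) (incl (R.coroot β)) • R.ghost W β := fun β hβ => by
    have hα : ∀ α ∈ P, R.ghost W (-α) * R.ghost W α * R.antighost I β
        = R.antighost I β * (R.ghost W (-α) * R.ghost W α)
          - if α = β then R.ghost W α else 0 := fun α hα => by
      rw [mul_assoc, hcb α β (hne0 α hα β hβ), mul_neg, ← mul_assoc]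
      split_ifs with h
      · rw [h, hcb' β hβ, sub_mul, one_mul, mul_assoc, neg_sub]
      · rw [hcb (-α) β fun h' => h (neg_injective h'), neg_mul, neg_neg, sub_zero, mul_assoc]
    have hs : ∑ α ∈ P, (if α = β then (χ + R.twoRho P) (incl (R.coroot α)) • R.ghost W α else 0)
        = (χ + R.twoRho P) (incl (R.coroot β)) • R.ghost W β := by
      rw [Finset.sum_ite_eq', if_pos hβ]
    simp only [kaehler, Finset.sum_mul, Finset.mul_sum, smul_mul_assoc, mul_smul_comm]
    rw [← hs, ← Finset.sum_sub_distrib]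
    refine Finset.sum_congr rfl fun α h => ?_
    rw [hα α h, smul_sub]
    split_ifs <;> simp
  have h2 : ∀ β ∈ P, R.kaehler W P χ * R.antighost I (-β) = R.antighost I (-β) * R.kaehler W P χ
      + (χ + R.twoRho P) (incl (R.coroot β)) • R.ghost W (-β) := fun β hβ => by
    have hα : ∀ α ∈ P, R.ghost W (-α) * R.ghost W α * R.antighost I (-β)
        = R.antighost I (-β) * (R.ghost W (-α) * R.ghost W α)
          + if α = β then R.ghost W (-α) else 0 := fun α hα => by
      have hc := hcb (-α) (-β) fun h' => hne0 α hα β hβ (neg_injective h')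
      rw [mul_assoc]
      split_ifs with h
      · rw [h] at hc ⊢
        rw [hcb'' β hβ, mul_sub, mul_one, ← mul_assoc, hc, neg_mul, mul_assoc]
        abel
      · rw [hcb α (-β) fun h' => h (by rw [h', neg_neg]), mul_neg, ← mul_assoc, hc, neg_mul,
          neg_neg, add_zero, mul_assoc]
    have hs : ∑ α ∈ P, (if α = β then
        (χ + R.twoRho P) (incl (R.coroot α)) • R.ghost W (-α) else 0)
        = (χ + R.twoRho P) (incl (R.coroot β)) • R.ghost W (-β) := by
      rw [Finset.sum_ite_eq', if_pos hβ]
    simp only [kaehler, Finset.sum_mul, Finset.mul_sum, smul_mul_assoc, mul_smul_comm]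
    rw [← hs, ← Finset.sum_add_distrib]
    refine Finset.sum_congr rfl fun α h => ?_
    rw [hα α h, smul_add]
    split_ifs <;> simp
  rw [dualKaehler, relNumber, Finset.mul_sum, Finset.sum_mul, ← Finset.sum_sub_distrib,
    ← Finset.sum_add_distrib]
  refine Finset.sum_congr rfl fun β hβ => ?_
  rw [mul_smul_comm, smul_mul_assoc, ← mul_assoc, h2 β hβ, add_mul, mul_assoc, h1 β hβ, mul_sub,
    mul_smul_comm, smul_mul_assoc, smul_add, smul_sub, smul_smul, smul_smul,
    inv_mul_cancel₀ (hne β hβ), one_smul, one_smul, mul_assoc]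
  abel

/-- On the joint kernel of the `i_{H_i}`, the relative ghost number is the number of factors of a
form, up to a shift. -/
lemma ghostNumber_eq :
    ghostNumber R.basis W I
      = ∑ i, W (R.basis.coord (Sum.inl i)) * I (incl (R.cartanVec i)) + R.relNumber W I P
        + (P.card : ℂ) • (1 : A) := by
  rw [ghostNumber, R.sum_basis hP (fun θ x => W θ * I x), relNumber,
    Finset.sum_congr rfl fun α hα => R.antighost_mul_ghost_neg hG hP hα, Finset.sum_sub_distrib,
    Finset.sum_const, ← Nat.cast_smul_eq_nsmul ℂ]
  simp only [ghost, antighost, neg_neg]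
  abel

omit hG in
lemma ghostNumber_mul_totalDiff (hGR : IsGhostRep W I ρ) :
    ghostNumber R.basis W I * R.totalDiff W I P χ ρ
      = R.totalDiff W I P χ ρ * (ghostNumber R.basis W I + 1) := by
  have hG := hGR.toIsGhostPair
  have h1 : ghostNumber R.basis W I * ∑ k, W (R.basis.coord k) * ρ (R.basis k)
      = (∑ k, W (R.basis.coord k) * ρ (R.basis k)) * (ghostNumber R.basis W I + 1) := by
    have hρ : ∀ x, ρ x * ghostNumber R.basis W I = ghostNumber R.basis W I * ρ x := fun x =>
      Commute.sum_right _ _ _ fun k _ =>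
        Commute.mul_right (hGR.rep_mul_left _ _) (hGR.rep_mul_right _ _)
    rw [Finset.mul_sum, Finset.sum_mul]
    refine Finset.sum_congr rfl fun k _ => ?_
    rw [← mul_assoc, hG.ghostNumber_mul_left, mul_assoc, mul_assoc, mul_add (ρ _), hρ, add_mul,
      one_mul, mul_one]
  rw [R.totalDiff_eq χ ρ hG hP, mul_sub, mul_add, h1, hG.ghostNumber_mul_ceDiff,
    hG.ghostNumber_mul_left, sub_mul, add_mul]

omit hP in
lemma ghostNumber_mul_dualKaehler :
    ghostNumber R.basis W I * R.dualKaehler I P χ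
      = R.dualKaehler I P χ * (ghostNumber R.basis W I - 2) := by
  rw [dualKaehler, Finset.mul_sum, Finset.sum_mul]
  refine Finset.sum_congr rfl fun α _ => ?_
  rw [mul_smul_comm, smul_mul_assoc, antighost, antighost, ← mul_assoc, hG.ghostNumber_mul_right,
    mul_assoc, sub_mul, hG.ghostNumber_mul_right, one_mul, mul_assoc, ← mul_sub_one, sub_sub,
    one_add_one_eq_two]

end RootBasis

end AnomalousDifferential

/-! ### Primitives of relative cocycles -/

section Vanishing

variable {L : Type*} [LieRing L] [LieAlgebra ℂ L] {M : Type*} [AddCommGroup M] [Module ℂ M]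
  {T : Type*} [AddCommGroup T] [Module ℂ T]
  {incl : T →ₗ[ℂ] L} {isRoot : Module.Dual ℂ T → Prop} {l : ℕ}

namespace RootBasis

variable (R : RootBasis incl isRoot l)
  {W : Module.Dual ℂ L →ₗ[ℂ] Module.End ℂ M} {I : L →ₗ[ℂ] Module.End ℂ M}
  {P : Finset (Module.Dual ℂ T)} {χ : Module.Dual ℂ L} {ρ : L →ₗ[ℂ] Module.End ℂ M}
  [Fintype {α // isRoot α}]

/-- A closed relative cochain `Ψ` of relative ghost number `r ≠ 0` is the coboundary of
`-r⁻¹ D Λ Ψ`, where `Λ` is dual to multiplication `L` by the Kähler form: as `L Ψ = -D² Ψ = 0`, one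
has `D² Λ Ψ = -[L, Λ] Ψ = -r Ψ`. -/
lemma exists_primitive (hGR : IsGhostRep W I ρ) (hP : IsPositiveChoice isRoot P)
    (hχ : ∀ α, χ (R.vec α) = 0) (hne : ∀ α ∈ P, (χ + R.twoRho P) (incl (R.coroot α)) ≠ 0)
    {r : ℂ} (hr : r ≠ 0) {Ψ : M} (hD : R.totalDiff W I P χ ρ Ψ = 0)
    (hT : ∀ h, R.cartanTotal W I P χ ρ h Ψ = 0) (hI : ∀ i, I (incl (R.cartanVec i)) Ψ = 0)
    (hn : R.relNumber W I P Ψ = r • Ψ) :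
    ∃ Φ : M, R.totalDiff W I P χ ρ (R.totalDiff W I P χ ρ Φ) = 0 ∧
      (∀ h, R.cartanTotal W I P χ ρ h Φ = 0) ∧ (∀ i, I (incl (R.cartanVec i)) Φ = 0) ∧
      R.relNumber W I P Φ = (r - 1) • Φ ∧ R.totalDiff W I P χ ρ Φ = Ψ := by
  have hG := hGR.toIsGhostPair
  set D := R.totalDiff W I P χ ρ with hDdef
  set Λ := R.dualKaehler I P χ with hΛ
  have hIΛ : ∀ x, I x (Λ Ψ) = Λ (I x Ψ) := fun x =>
    LinearMap.congr_fun (R.incl_mul_dualKaehler (P := P) (χ := χ) hG x) Ψ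
  have hTD : ∀ h Φ, R.cartanTotal W I P χ ρ h (D Φ) = D (R.cartanTotal W I P χ ρ h Φ) :=
    fun h Φ => LinearMap.congr_fun (R.cartanTotal_mul_totalDiff hP hGR hχ h) Φ
  have hTΛ : ∀ h, R.cartanTotal W I P χ ρ h (Λ Ψ) = 0 := fun h => by
    have := LinearMap.congr_fun (R.cartanTotal_mul_dualKaehler (χ := χ) hP hGR h) Ψ
    rw [Module.End.mul_apply, Module.End.mul_apply, hT, map_zero] at this
    exact this
  have hID : ∀ i, I (incl (R.cartanVec i)) (D (Λ Ψ)) = 0 := fun i => by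
    have := LinearMap.congr_fun (R.totalDiff_mul_incl (χ := χ) hP hGR (R.cartanVec i)) (Λ Ψ)
    rw [Module.End.mul_apply, LinearMap.sub_apply, Module.End.mul_apply, hTΛ, hIΛ, hI, map_zero,
      map_zero, zero_sub] at this
    exact neg_eq_zero.mp this.symm
  have hDD : ∀ Φ, D (D Φ) = -R.kaehler W P χ Φ := fun Φ =>
    LinearMap.congr_fun (R.totalDiff_mul_self hP hGR hχ) Φ
  have hLΨ : R.kaehler W P χ Ψ = 0 := by
    rw [← neg_eq_zero, ← hDD, hD, map_zero]
  have hDDΛ : D (D (Λ Ψ)) = -(r • Ψ) := by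
    have := LinearMap.congr_fun (R.kaehler_mul_dualKaehler (χ := χ) hG hP hne) Ψ
    rw [Module.End.mul_apply, LinearMap.add_apply, Module.End.mul_apply, hLΨ, map_zero, zero_add,
      hn] at this
    rw [hDD, this]
  -- The relative ghost number is read off from the total number of factors.
  have hnum : ∀ Φ, (∀ i, I (incl (R.cartanVec i)) Φ = 0) →
      ghostNumber R.basis W I Φ = R.relNumber W I P Φ + (P.card : ℂ) • Φ := fun Φ hΦ => by
    rw [R.ghostNumber_eq hG hP]
    simp [LinearMap.sum_apply, hΦ]
  have hnD : ghostNumber R.basis W I (D (Λ Ψ)) = (r + P.card - 1) • D (Λ Ψ) := by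
    have h1 := LinearMap.congr_fun (R.ghostNumber_mul_totalDiff (χ := χ) hP hGR) (Λ Ψ)
    have h2 := LinearMap.congr_fun
      (R.ghostNumber_mul_dualKaehler (P := P) (χ := χ) hG) Ψ
    rw [Module.End.mul_apply, Module.End.mul_apply] at h1 h2
    rw [LinearMap.sub_apply, hnum Ψ hI, hn] at h2
    rw [LinearMap.add_apply, h2] at h1
    have h3 : (2 : Module.End ℂ M) Ψ = (2 : ℂ) • Ψ := by
      rw [← one_add_one_eq_two, ← one_add_one_eq_two, add_smul]; simp
    rw [h1, h3, Module.End.one_apply, ← map_smul]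
    congr 1
    simp only [map_sub, map_add, map_smul]
    module
  refine ⟨-(r⁻¹) • D (Λ Ψ), ?_, fun h => ?_, fun i => ?_, ?_, ?_⟩
  · rw [map_smul, map_smul, hDDΛ, map_neg, map_smul, hD, smul_zero, neg_zero, smul_zero]
  · rw [map_smul, hTD, hTΛ, map_zero, smul_zero]
  · rw [map_smul, hID, smul_zero]
  · have := hnum _ hID
    rw [hnD] at this
    rw [map_smul, eq_sub_of_add_eq this.symm]
    module
  · rw [map_smul, hDDΛ, smul_neg, neg_smul, neg_neg, smul_smul, inv_mul_cancel₀ hr, one_smul]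

end RootBasis

end Vanishing

/-! ### Vacuum cochains and the coefficient at the vacuum -/

section Vacuum

variable {L : Type*} [LieRing L] [LieAlgebra ℂ L] {M : Type*} [AddCommGroup M] [Module ℂ M]
  {T : Type*} [AddCommGroup T] [Module ℂ T]
  {incl : T →ₗ[ℂ] L} {isRoot : Module.Dual ℂ T → Prop} {l : ℕ}

namespace RootBasis

variable (R : RootBasis incl isRoot l)
  {W : Module.Dual ℂ L →ₗ[ℂ] Module.End ℂ M} {I : L →ₗ[ℂ] Module.End ℂ M}
  {P : Finset (Module.Dual ℂ T)} {χ : Module.Dual ℂ L} {ρ : L →ₗ[ℂ] Module.End ℂ M}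

variable (W I P) in
/-- The cochains of the form `ω ⊗ φ`: those annihilated by `c^α` and `b_α` for `α > 0` and by the
substitution of the vectors of `T`. -/
structure IsVacuum (Ψ : M) : Prop where
  ghost_eq_zero : ∀ α ∈ P, R.ghost W α Ψ = 0
  antighost_eq_zero : ∀ α ∈ P, R.antighost I α Ψ = 0
  incl_eq_zero : ∀ h, I (incl h) Ψ = 0

variable (W I P) in
/-- The functionals that vanish on the images of `c^{-α}` and `b_{-α}` for `α > 0` and of the `c^i`,
such as the coefficient at `ω`. -/
structure IsCovacuum {N : Type*} [AddCommGroup N] [Module ℂ N] (f : M →ₗ[ℂ] N) : Prop where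
  apply_ghost : ∀ α ∈ P, ∀ Φ, f (R.ghost W (-α) Φ) = 0
  apply_antighost : ∀ α ∈ P, ∀ Φ, f (R.antighost I (-α) Φ) = 0
  apply_cartan : ∀ i Φ, f (W (R.basis.coord (Sum.inl i)) Φ) = 0

lemma IsVacuum.cartanGhost_eq_zero {R : RootBasis incl isRoot l} {Ψ : M}
    (hΨ : R.IsVacuum W I P Ψ) (h : T) : R.cartanGhost W I P h Ψ = 0 := by
  rw [cartanGhost, LinearMap.smul_apply, LinearMap.add_apply, LinearMap.sum_apply,
    LinearMap.sum_apply, Finset.sum_eq_zero, Finset.sum_eq_zero, add_zero, smul_zero]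
  · intro β hβ
    rw [LinearMap.smul_apply, Module.End.mul_apply, hΨ.ghost_eq_zero β hβ, map_zero, smul_zero]
  · intro β hβ
    rw [LinearMap.smul_apply, Module.End.mul_apply, hΨ.antighost_eq_zero β hβ, map_zero, smul_zero]

lemma antighost_add_eq_zero (hP : IsPositiveChoice isRoot P) {Ψ : M}
    (hΨ : R.IsVacuum W I P Ψ) {α β : Module.Dual ℂ T} (hα : α ∈ P) (hβ : β ∈ P) :
    I (R.vec (α + β)) Ψ = 0 := by
  by_cases hr : isRoot (α + β)
  · exact hΨ.antighost_eq_zero _ (hP.add_mem α hα β hβ hr)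
  · rw [R.vec_of_not hr, map_zero, LinearMap.zero_apply]

lemma apply_antighost_add (hP : IsPositiveChoice isRoot P) {N : Type*} [AddCommGroup N]
    [Module ℂ N] {f : M →ₗ[ℂ] N} (hf : R.IsCovacuum W I P f) {α β : Module.Dual ℂ T}
    (hα : α ∈ P) (hβ : β ∈ P) (Φ : M) : f (I (R.vec (-α + -β)) Φ) = 0 := by
  rw [← neg_add]
  by_cases hr : isRoot (-(α + β))
  · exact hf.apply_antighost _ (hP.add_mem α hα β hβ (neg_neg (α + β) ▸ R.isRoot_neg _ hr)) Φ
  · rw [R.vec_of_not hr, map_zero, LinearMap.zero_apply, map_zero]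

lemma left_mul_right_of_ne (hG : IsGhostPair W I) {α β : Module.Dual ℂ T} (h : α ≠ β) (Φ : M) :
    W (R.form α) (I (R.vec β) Φ) = -I (R.vec β) (W (R.form α) Φ) := by
  have := LinearMap.congr_fun (hG.right_left (R.vec β) (R.form α)) Φ
  rw [R.form_vec_of_ne h, zero_smul, zero_sub] at this
  simp only [Module.End.mul_apply, LinearMap.neg_apply] at this
  rw [this, neg_neg]

variable [Fintype {α // isRoot α}]

lemma coad_vec_eq_zero (hG : IsGhostPair W I) (hP : IsPositiveChoice isRoot P) {Ψ : M}
    (hΨ : R.IsVacuum W I P Ψ) {α : Module.Dual ℂ T} (hα : α ∈ P) :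
    coad R.basis W I (R.vec α) Ψ = 0 := by
  have h1 : ∀ i, (W (R.basis.coord (Sum.inl i)) * I ⁅R.vec α, incl (R.cartanVec i)⁆) Ψ = 0 :=
    fun i => by
      have h0 : I (R.vec α) Ψ = 0 := hΨ.antighost_eq_zero α hα
      rw [R.vec_lie, map_neg, map_smul, Module.End.mul_apply, LinearMap.neg_apply,
        LinearMap.smul_apply, h0, smul_zero, neg_zero, map_zero]
  have h2 : ∀ γ ∈ P, (W (R.form γ) * I ⁅R.vec α, R.vec γ⁆) Ψ = 0 := fun γ hγ => by
    obtain ⟨N, hN⟩ := R.vec_lie_vec α γ fun h =>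
      hP.neg_notMem γ hγ (eq_neg_of_add_eq_zero_left h ▸ hα)
    rw [hN, map_smul, Module.End.mul_apply, LinearMap.smul_apply,
      R.antighost_add_eq_zero hP hΨ hα hγ, smul_zero, map_zero]
  have h3 : ∀ γ ∈ P, (W (R.form (-γ)) * I ⁅R.vec α, R.vec (-γ)⁆) Ψ = 0 := fun γ hγ => by
    rw [Module.End.mul_apply]
    by_cases h : γ = α
    · rw [h, R.vec_lie_neg (hP.isRoot_of_mem α hα), map_neg, LinearMap.neg_apply,
        hΨ.incl_eq_zero, neg_zero, map_zero]
    · obtain ⟨N, hN⟩ := R.vec_lie_vec α (-γ) fun h' => h (by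
        rw [eq_neg_of_add_eq_zero_left h', neg_neg])
      have h0 : W (R.form (-γ)) Ψ = 0 := hΨ.ghost_eq_zero γ hγ
      rw [hN, map_smul, LinearMap.smul_apply, map_smul, R.left_mul_right_of_ne hG, h0, map_zero,
        neg_zero, smul_zero]
      intro h'
      exact R.ne_zero α (hP.isRoot_of_mem α hα) (by simpa using h')
  rw [coad_apply, R.sum_basis hP (fun θ x => W θ * I ⁅R.vec α, x⁆)]
  simp only [LinearMap.neg_apply, LinearMap.add_apply, LinearMap.sum_apply]
  rw [Finset.sum_eq_zero fun i _ => h1 i, Finset.sum_eq_zero h2, Finset.sum_eq_zero h3, add_zero,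
    add_zero, neg_zero]

lemma apply_coad_vec_neg (hG : IsGhostPair W I) (hP : IsPositiveChoice isRoot P) {N : Type*}
    [AddCommGroup N] [Module ℂ N] {f : M →ₗ[ℂ] N} (hf : R.IsCovacuum W I P f)
    {α : Module.Dual ℂ T} (hα : α ∈ P) (Φ : M) :
    f (coad R.basis W I (R.vec (-α)) Φ) = 0 := by
  have h2 : ∀ γ ∈ P, f ((W (R.form γ) * I ⁅R.vec (-α), R.vec γ⁆) Φ) = 0 := fun γ hγ => by
    have := hf.apply_ghost γ hγ (I ⁅R.vec (-α), R.vec γ⁆ Φ)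
    rwa [ghost, neg_neg] at this
  have h3 : ∀ γ ∈ P, f ((W (R.form (-γ)) * I ⁅R.vec (-α), R.vec (-γ)⁆) Φ) = 0 := fun γ hγ => by
    obtain ⟨N, hN⟩ := R.vec_lie_vec (-α) (-γ) fun h =>
      hP.neg_notMem α hα (eq_neg_of_add_eq_zero_left h ▸ (neg_neg γ).symm ▸ hγ)
    rw [hN, map_smul, Module.End.mul_apply, LinearMap.smul_apply, map_smul,
      R.left_mul_right_of_ne hG, smul_neg, map_neg, map_smul, R.apply_antighost_add hP hf hα hγ,
      smul_zero, neg_zero]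
    intro h'
    exact R.ne_zero α (hP.isRoot_of_mem α hα) (by simpa using h')
  rw [coad_apply, R.sum_basis hP (fun θ x => W θ * I ⁅R.vec (-α), x⁆)]
  simp only [LinearMap.neg_apply, LinearMap.add_apply, LinearMap.sum_apply, map_neg, map_add,
    map_sum]
  rw [Finset.sum_eq_zero fun i _ => by rw [Module.End.mul_apply, hf.apply_cartan],
    Finset.sum_eq_zero h2,
    Finset.sum_eq_zero h3, add_zero, add_zero, neg_zero]

/-- On `ω ⊗ φ` with `φ` of weight `χ`, only the positive root vectors contribute to the
differential. -/
lemma totalDiff_vacuum (hGR : IsGhostRep W I ρ) (hP : IsPositiveChoice isRoot P) {Ψ : M}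
    (hΨ : R.IsVacuum W I P Ψ) (hT : ∀ h, shifted χ ρ (incl h) Ψ = 0) :
    R.totalDiff W I P χ ρ Ψ = ∑ α ∈ P, R.ghost W (-α) (shifted χ ρ (R.vec α) Ψ) := by
  have h1 : ∀ α ∈ P, R.ghost W α (shifted χ ρ (R.vec (-α)) Ψ) = 0 := fun α hα => by
    have h0 : W (R.form (-α)) Ψ = 0 := hΨ.ghost_eq_zero α hα
    have h2 := LinearMap.congr_fun (hGR.rep_mul_left (R.vec (-α)) (R.form (-α))) Ψ
    rw [Module.End.mul_apply, Module.End.mul_apply, h0, map_zero] at h2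
    rw [ghost, shifted, LinearMap.sub_apply, map_sub, ← h2, LinearMap.smul_apply,
      Module.End.one_apply, map_smul, h0, smul_zero, sub_zero]
  rw [totalDiff, normalDiff]
  simp only [LinearMap.add_apply, LinearMap.smul_apply, LinearMap.sum_apply, Module.End.mul_apply,
    hT, hΨ.cartanGhost_eq_zero, map_zero, Finset.sum_const_zero, smul_zero, add_zero]
  have h2 : ∑ α ∈ P, R.ghost W (-α) (coad R.basis W I (R.vec α) Ψ) = 0 :=
    Finset.sum_eq_zero fun α hα => by
      rw [R.coad_vec_eq_zero hGR.toIsGhostPair hP hΨ hα, map_zero]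
  have h3 : ∑ α ∈ P, coad R.basis W I (R.vec (-α)) (R.ghost W α Ψ) = 0 :=
    Finset.sum_eq_zero fun α hα => by rw [hΨ.ghost_eq_zero α hα, map_zero]
  rw [Finset.sum_add_distrib, Finset.sum_eq_zero h1, h2, h3, smul_zero, add_zero, add_zero,
    add_zero]

/-- The coefficient of `D Φ` at `ω` only involves the negative root vectors. -/
lemma apply_totalDiff (hG : IsGhostPair W I) (hP : IsPositiveChoice isRoot P) {N : Type*}
    [AddCommGroup N] [Module ℂ N] {f : M →ₗ[ℂ] N} (hf : R.IsCovacuum W I P f) (Φ : M) :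
    f (R.totalDiff W I P χ ρ Φ) = ∑ α ∈ P, f (R.ghost W α (shifted χ ρ (R.vec (-α)) Φ)) := by
  rw [totalDiff, normalDiff]
  simp only [LinearMap.add_apply, LinearMap.smul_apply, LinearMap.sum_apply, Module.End.mul_apply,
    map_add, map_smul, map_sum]
  rw [Finset.sum_add_distrib, Finset.sum_eq_zero fun α hα => hf.apply_ghost α hα _,
    Finset.sum_eq_zero fun i _ => hf.apply_cartan i _,
    Finset.sum_eq_zero fun α hα => hf.apply_ghost α hα _,
    Finset.sum_eq_zero fun α hα => R.apply_coad_vec_neg hG hP hf hα _,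
    Finset.sum_eq_zero fun i _ => hf.apply_cartan i _]
  simp

end RootBasis

end Vacuum

/-! ### The compact real form -/

section CompactForm

variable {𝔤 : Type*} [LieRing 𝔤] [LieAlgebra ℝ 𝔤]

@[simp] lemma conj_tmul (z : ℂ) (x : 𝔤) : conj 𝔤 (z ⊗ₜ[ℝ] x) = (starRingEnd ℂ z) ⊗ₜ[ℝ] x := rfl

lemma conj_lie (x y : ℂ ⊗[ℝ] 𝔤) : conj 𝔤 ⁅x, y⁆ = ⁅conj 𝔤 x, conj 𝔤 y⁆ := by
  have hadd : ∀ x y z : ℂ ⊗[ℝ] 𝔤, ⁅x, y + z⁆ = ⁅x, y⁆ + ⁅x, z⁆ := fun x y z =>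
    map_add (LieAlgebra.ad ℂ (ℂ ⊗[ℝ] 𝔤) x) y z
  have hzero : ∀ x : ℂ ⊗[ℝ] 𝔤, ⁅x, (0 : ℂ ⊗[ℝ] 𝔤)⁆ = 0 := fun x =>
    map_zero (LieAlgebra.ad ℂ (ℂ ⊗[ℝ] 𝔤) x)
  induction x using TensorProduct.induction_on with
  | zero => simp
  | add x x' hx hx' => simp [add_lie, hx, hx']
  | tmul z x =>
    induction y using TensorProduct.induction_on with
    | zero => rw [hzero, map_zero, hzero]
    | add y y' hy hy' => rw [hadd, map_add, hy, hy', map_add, hadd]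
    | tmul w y => simp [LieAlgebra.ExtendScalars.bracket_tmul]

lemma exists_re_im (x : ℂ ⊗[ℝ] 𝔤) :
    ∃ u v : 𝔤, x = (1 : ℂ) ⊗ₜ[ℝ] u + Complex.I ⊗ₜ[ℝ] v := by
  induction x using TensorProduct.induction_on with
  | zero => exact ⟨0, 0, by simp⟩
  | add x x' hx hx' =>
    obtain ⟨u, v, rfl⟩ := hx
    obtain ⟨u', v', rfl⟩ := hx'
    exact ⟨u + u', v + v', by simp only [tmul_add]; abel⟩
  | tmul z x =>
    refine ⟨z.re • x, z.im • x, ?_⟩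
    rw [← smul_tmul, ← smul_tmul, ← add_tmul]
    congr 1
    simp [Complex.re_add_im]

lemma isKilling_of_negDef (hcompact : ∀ x : 𝔤, x ≠ 0 → killingForm ℝ 𝔤 x x < 0) :
    LieAlgebra.IsKilling ℝ 𝔤 := by
  constructor
  rw [eq_bot_iff]
  intro x hx
  rw [LieIdeal.mem_killingCompl] at hx
  by_contra h0
  exact (hcompact x h0).ne (hx x trivial)

/-- On a compact Lie algebra, `κ(x, x̄)` is a negative definite Hermitian form. -/
lemma killingForm_conj_neg (hcompact : ∀ x : 𝔤, x ≠ 0 → killingForm ℝ 𝔤 x x < 0)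
    {x : ℂ ⊗[ℝ] 𝔤} (hx : x ≠ 0) :
    ∃ r : ℝ, r < 0 ∧ (killingForm ℝ 𝔤).baseChange ℂ x (conj 𝔤 x) = r := by
  obtain ⟨u, v, rfl⟩ := exists_re_im x
  refine ⟨killingForm ℝ 𝔤 u u + killingForm ℝ 𝔤 v v, ?_, ?_⟩
  · have hle : ∀ w : 𝔤, killingForm ℝ 𝔤 w w ≤ 0 := fun w => by
      rcases eq_or_ne w 0 with rfl | hw
      · simp
      · exact (hcompact w hw).le
    rcases eq_or_ne u 0 with rfl | hu
    · rcases eq_or_ne v 0 with rfl | hv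
      · simp at hx
      · linarith [hle 0, hcompact v hv]
    · linarith [hle v, hcompact u hu]
  · have hs : killingForm ℝ 𝔤 v u = killingForm ℝ 𝔤 u v := LieModule.traceForm_comm _ _ _ _ _
    simp [hs]

/-- The complexified Cartan subalgebra is abelian. -/
lemma lie_cartan_cartan [Module.Finite ℝ 𝔤]
    (hcompact : ∀ x : 𝔤, x ≠ 0 → killingForm ℝ 𝔤 x x < 0)
    (𝔱 : LieSubalgebra ℝ 𝔤) [𝔱.IsCartanSubalgebra] (h h' : cartan 𝔱) :
    ⁅(h : ℂ ⊗[ℝ] 𝔤), (h' : ℂ ⊗[ℝ] 𝔤)⁆ = 0 := by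
  have := isKilling_of_negDef hcompact
  have key : ∀ u ∈ 𝔱, ∀ v ∈ 𝔱, ⁅u, v⁆ = 0 := fun u hu v hv => by
    have := LieModule.IsTrivial.trivial (⟨u, hu⟩ : 𝔱) (⟨v, hv⟩ : 𝔱)
    exact congrArg Subtype.val this
  obtain ⟨x, hx⟩ := h
  obtain ⟨y, hy⟩ := h'
  rw [cartan, Submodule.baseChange_eq_span] at hx hy
  have h1 : ∀ v ∈ 𝔱, Submodule.span ℂ (𝔱.toSubmodule.map (TensorProduct.mk ℝ ℂ 𝔤 1) :
      Set (ℂ ⊗[ℝ] 𝔤)) ≤ LinearMap.ker (LieAlgebra.ad ℂ (ℂ ⊗[ℝ] 𝔤) ((1 : ℂ) ⊗ₜ[ℝ] v) :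
        Module.End ℂ (ℂ ⊗[ℝ] 𝔤)) := fun v hv => by
    rw [Submodule.span_le]
    rintro _ ⟨u, hu, rfl⟩
    simp [LieAlgebra.ExtendScalars.bracket_tmul, key v hv u hu]
  have h2 : Submodule.span ℂ (𝔱.toSubmodule.map (TensorProduct.mk ℝ ℂ 𝔤 1) :
      Set (ℂ ⊗[ℝ] 𝔤)) ≤ LinearMap.ker (LieAlgebra.ad ℂ (ℂ ⊗[ℝ] 𝔤) x :
        Module.End ℂ (ℂ ⊗[ℝ] 𝔤)) := by
    rw [Submodule.span_le]
    rintro _ ⟨v, hv, rfl⟩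
    have := h1 v hv hx
    rw [LinearMap.mem_ker, LieAlgebra.ad_apply] at this
    rw [SetLike.mem_coe, LinearMap.mem_ker, LieAlgebra.ad_apply, ← lie_skew]
    exact neg_eq_zero.mpr this
  exact h2 hy

end CompactForm

/-! ### The ghost representation on cochains -/

section Instantiation

variable {𝔤 : Type*} [LieRing 𝔤] [LieAlgebra ℝ 𝔤] {𝔱 : LieSubalgebra ℝ 𝔤} {l : ℕ}
  (C : ChevalleyBasis 𝔱 l)

lemma ChevalleyBasis.isRoot_neg (C : ChevalleyBasis 𝔱 l) {α : Module.Dual ℂ (cartan 𝔱)}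
    (hα : IsRoot 𝔱 α) : IsRoot 𝔱 (-α) := by
  by_contra hn
  have h1 : rootVector C.basis (-α) = 0 := by simp only [rootVector, hn, dite_false]
  have h2 : rootVector C.basis α = C.basis (Sum.inr ⟨α, hα⟩) := by
    simp only [rootVector, hα, dite_true]
  have h3 := C.conj_rootVector α hα
  rw [h1, h2] at h3
  have h4 : Function.Injective (conj 𝔤) :=
    Module.Flat.rTensor_preserves_injective_linearMap _ Complex.conjAe.injective
  -- If `-α` were not a root, `τ_{-α} = 0` would be the conjugate of `τ_α ≠ 0`.
  exact C.basis.ne_zero _ (h4 (h3.trans (map_zero _).symm))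

/-- The root basis of the complexification given by a Chevalley basis. -/
def ChevalleyBasis.rootBasis (hab : ∀ h h' : cartan 𝔱, ⁅(h : ℂ ⊗[ℝ] 𝔤), (h' : ℂ ⊗[ℝ] 𝔤)⁆ = 0) :
    RootBasis (L := ℂ ⊗[ℝ] 𝔤) (cartan 𝔱).subtype (IsRoot 𝔱) l where
  basis := C.basis
  cartanVec := C.cartanVec
  coroot := C.coroot
  basis_inl := C.basis_inl
  ne_zero := fun α hα => hα.1
  isRoot_neg := fun α hα => C.isRoot_neg hα
  lie_incl := hab
  lie_basis := C.lie_cartan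
  lie_neg := fun α hα => by
    have h := C.lie_neg α hα
    simp only [rootVector, hα, C.isRoot_neg hα, dite_true] at h
    exact h
  apply_coroot := C.apply_coroot
  lie_root := fun α β hα hβ hαβ => by
    obtain ⟨N, hN⟩ := C.lie_rootVector α β hα hβ hαβ
    simp only [rootVector, hα, hβ, dite_true] at hN
    by_cases hr : IsRoot 𝔱 (α + β)
    · simp only [hr, dite_true] at hN
      exact Or.inl ⟨hr, N, hN⟩
    · simp only [hr, dite_false] at hN
      exact Or.inr (hN.trans (smul_zero _))

lemma ChevalleyBasis.finite_root [Module.Finite ℝ 𝔤] (C : ChevalleyBasis 𝔱 l) :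
    Finite (Root 𝔱) :=
  have := Module.Finite.finite_basis C.basis
  Finite.of_injective (Sum.inr : Root 𝔱 → Fin l ⊕ Root 𝔱) Sum.inr_injective

lemma IsPositiveSystem.isPositiveChoice {P : Finset (Module.Dual ℂ (cartan 𝔱))}
    (hP : IsPositiveSystem 𝔱 P) : IsPositiveChoice (IsRoot 𝔱) P where
  isRoot_of_mem := hP.isRoot
  neg_notMem := hP.neg_notMem
  mem_or_neg_mem := hP.mem_or_neg_mem
  add_mem := hP.add_mem

variable (V : Type*) [NormedAddCommGroup V] [InnerProductSpace ℂ V]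

variable (𝔤) in
/-- Multiplication of cochains by one-forms. -/
def wedgeOp : Module.Dual ℂ (ℂ ⊗[ℝ] 𝔤) →ₗ[ℂ] Module.End ℂ (Cochain 𝔤 V) :=
  LinearMap.rTensorHom V ∘ₗ (LinearMap.mul ℂ (Ghost 𝔤)) ∘ₗ ExteriorAlgebra.ι ℂ

variable (𝔤) in
/-- Substitution of vectors into cochains. -/
def contractOp : (ℂ ⊗[ℝ] 𝔤) →ₗ[ℂ] Module.End ℂ (Cochain 𝔤 V) :=
  LinearMap.rTensorHom V ∘ₗ (CliffordAlgebra.contractLeft (Q := 0)) ∘ₗ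
    Module.Dual.eval ℂ (ℂ ⊗[ℝ] 𝔤)

variable {V} in
/-- The action on the coefficients of cochains, extended to the complexification. -/
def repOp (ρ : 𝔤 →ₗ[ℝ] (V →ₗ[ℂ] V)) : (ℂ ⊗[ℝ] 𝔤) →ₗ[ℂ] Module.End ℂ (Cochain 𝔤 V) :=
  LinearMap.lTensorHom (Ghost 𝔤) ∘ₗ ρ.liftBaseChange ℂ

lemma wedgeOp_tmul (θ : Module.Dual ℂ (ℂ ⊗[ℝ] 𝔤)) (ψ : Ghost 𝔤) (v : V) :
    wedgeOp 𝔤 V θ (ψ ⊗ₜ v) = (ExteriorAlgebra.ι ℂ θ * ψ) ⊗ₜ v := rfl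

lemma contractOp_tmul (x : ℂ ⊗[ℝ] 𝔤) (ψ : Ghost 𝔤) (v : V) :
    contractOp 𝔤 V x (ψ ⊗ₜ v) = contract x ψ ⊗ₜ v := rfl

lemma liftBaseChange_lie {ρ : 𝔤 →ₗ[ℝ] (V →ₗ[ℂ] V)}
    (hρ : ∀ x y : 𝔤, ρ ⁅x, y⁆ = ρ x ∘ₗ ρ y - ρ y ∘ₗ ρ x) (x y : ℂ ⊗[ℝ] 𝔤) (v : V) :
    ρ.liftBaseChange ℂ x (ρ.liftBaseChange ℂ y v)
      = ρ.liftBaseChange ℂ y (ρ.liftBaseChange ℂ x v) + ρ.liftBaseChange ℂ ⁅x, y⁆ v := by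
  have hadd : ∀ x y z : ℂ ⊗[ℝ] 𝔤, ⁅x, y + z⁆ = ⁅x, y⁆ + ⁅x, z⁆ := fun x y z =>
    map_add (LieAlgebra.ad ℂ (ℂ ⊗[ℝ] 𝔤) x) y z
  have hzero : ∀ x : ℂ ⊗[ℝ] 𝔤, ⁅x, (0 : ℂ ⊗[ℝ] 𝔤)⁆ = 0 := fun x =>
    map_zero (LieAlgebra.ad ℂ (ℂ ⊗[ℝ] 𝔤) x)
  induction x using TensorProduct.induction_on with
  | zero => simp
  | add x x' hx hx' =>
    simp only [map_add, LinearMap.add_apply, add_lie, hx, hx']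
    abel
  | tmul z x =>
    induction y using TensorProduct.induction_on with
    | zero => rw [hzero]; simp
    | add y y' hy hy' =>
      rw [hadd]
      simp only [map_add, LinearMap.add_apply, hy, hy']
      abel
    | tmul w y =>
      simp only [LieAlgebra.ExtendScalars.bracket_tmul, LinearMap.liftBaseChange_tmul,
        LinearMap.smul_apply, map_smul, hρ, LinearMap.sub_apply, LinearMap.comp_apply, smul_smul,
        mul_comm w z, smul_sub, add_sub_cancel]

/-- The ghosts, the anti-ghosts and the representation on cochains satisfy the abstract
relations. -/
lemma isGhostRep {ρ : 𝔤 →ₗ[ℝ] (V →ₗ[ℂ] V)}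
    (hρ : ∀ x y : 𝔤, ρ ⁅x, y⁆ = ρ x ∘ₗ ρ y - ρ y ∘ₗ ρ x) :
    IsGhostRep (L := ℂ ⊗[ℝ] 𝔤) (A := Module.End ℂ (Cochain 𝔤 V)) (wedgeOp 𝔤 V) (contractOp 𝔤 V)
      (repOp ρ) where
  mul_self_left θ := TensorProduct.ext' fun ψ v => by
    rw [Module.End.mul_apply, wedgeOp_tmul, wedgeOp_tmul, ← mul_assoc, ExteriorAlgebra.ι_sq_zero,
      zero_mul, zero_tmul, LinearMap.zero_apply]
  left_left θ η := TensorProduct.ext' fun ψ v => by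
    have h := eq_neg_of_add_eq_zero_left (ExteriorAlgebra.ι_add_mul_swap (R := ℂ) θ η)
    rw [Module.End.mul_apply, LinearMap.neg_apply, Module.End.mul_apply, wedgeOp_tmul,
      wedgeOp_tmul, wedgeOp_tmul, wedgeOp_tmul, ← mul_assoc, h, neg_mul, neg_tmul, mul_assoc]
  right_right x y := TensorProduct.ext' fun ψ v => by
    have h : contract x (contract y ψ) = -contract y (contract x ψ) :=
      CliffordAlgebra.contractLeft_comm _ _ _
    rw [Module.End.mul_apply, LinearMap.neg_apply, Module.End.mul_apply, contractOp_tmul,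
      contractOp_tmul, contractOp_tmul, contractOp_tmul, h, neg_tmul]
  right_left x θ := TensorProduct.ext' fun ψ v => by
    have h : contract x (ExteriorAlgebra.ι ℂ θ * ψ)
        = θ x • ψ - ExteriorAlgebra.ι ℂ θ * contract x ψ :=
      CliffordAlgebra.contractLeft_ι_mul _ _ _
    rw [Module.End.mul_apply, LinearMap.sub_apply, Module.End.mul_apply, wedgeOp_tmul,
      contractOp_tmul, contractOp_tmul, wedgeOp_tmul, h, sub_tmul, LinearMap.smul_apply,
      Module.End.one_apply, smul_tmul']
  rep_mul_rep x y := TensorProduct.ext' fun ψ v =>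
    (congrArg (ψ ⊗ₜ[ℂ] ·) (liftBaseChange_lie V hρ x y v)).trans (tmul_add _ _ _)
  rep_mul_left x θ := TensorProduct.ext' fun ψ v => rfl
  rep_mul_right x y := TensorProduct.ext' fun ψ v => rfl

end Instantiation

/-! ### The operators on cochains in terms of the root basis -/

section Translation

variable {𝔤 : Type*} [LieRing 𝔤] [LieAlgebra ℝ 𝔤]
  {𝔱 : LieSubalgebra ℝ 𝔤} {l : ℕ}
  {V : Type*} [NormedAddCommGroup V] [InnerProductSpace ℂ V]

lemma onGhost_mul (a b : Module.End ℂ (Ghost 𝔤)) :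
    onGhost (V := V) (a * b) = onGhost (V := V) a * onGhost (V := V) b :=
  LinearMap.rTensor_mul V a b

lemma onGhost_add (a b : Module.End ℂ (Ghost 𝔤)) :
    onGhost (V := V) (a + b) = onGhost (V := V) a + onGhost (V := V) b :=
  LinearMap.rTensor_add V a b

lemma onGhost_sub (a b : Module.End ℂ (Ghost 𝔤)) :
    onGhost (V := V) (a - b) = onGhost (V := V) a - onGhost (V := V) b :=
  map_sub (LinearMap.rTensorHom V) a b

lemma onGhost_smul (z : ℂ) (a : Module.End ℂ (Ghost 𝔤)) :
    onGhost (V := V) (z • a) = z • onGhost (V := V) a :=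
  LinearMap.rTensor_smul V z a

lemma onGhost_sum {ι : Type*} (s : Finset ι) (f : ι → Module.End ℂ (Ghost 𝔤)) :
    onGhost (V := V) (∑ i ∈ s, f i) = ∑ i ∈ s, onGhost (V := V) (f i) :=
  map_sum (LinearMap.rTensorHom V) f s

namespace ChevalleyBasis

variable (C : ChevalleyBasis 𝔱 l)
  (hab : ∀ h h' : cartan 𝔱, ⁅(h : ℂ ⊗[ℝ] 𝔤), (h' : ℂ ⊗[ℝ] 𝔤)⁆ = 0)

lemma ghost_rootBasis (α : Module.Dual ℂ (cartan 𝔱)) :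
    (C.rootBasis hab).ghost (A := Module.End ℂ (Cochain 𝔤 V)) (wedgeOp 𝔤 V) α
      = onGhost (C.c α) := rfl

lemma antighost_rootBasis (α : Module.Dual ℂ (cartan 𝔱)) :
    (C.rootBasis hab).antighost (A := Module.End ℂ (Cochain 𝔤 V)) (contractOp 𝔤 V) α
      = onGhost (C.b α) := rfl

lemma cartanGhost_rootBasis (P : Finset (Module.Dual ℂ (cartan 𝔱))) (h : cartan 𝔱) :
    (C.rootBasis hab).cartanGhost (A := Module.End ℂ (Cochain 𝔤 V)) (wedgeOp 𝔤 V)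
      (contractOp 𝔤 V) P h = onGhost (C.ghostCartan P h) := by
  simp only [ghostCartan, onGhost_smul, onGhost_add, onGhost_sum, onGhost_mul]
  rfl

lemma relNumber_rootBasis (P : Finset (Module.Dual ℂ (cartan 𝔱))) :
    (C.rootBasis hab).relNumber (A := Module.End ℂ (Cochain 𝔤 V)) (wedgeOp 𝔤 V)
      (contractOp 𝔤 V) P = onGhost (C.ghRel P) := by
  simp only [ghRel, ghBar, gh, onGhost_sub, onGhost_sum, onGhost_mul]
  rfl

variable [Module.Finite ℝ 𝔤] [Fintype (Root 𝔱)]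

lemma coad_rootBasis (x : ℂ ⊗[ℝ] 𝔤) :
    coad (A := Module.End ℂ (Cochain 𝔤 V)) (C.rootBasis hab).basis (wedgeOp 𝔤 V)
      (contractOp 𝔤 V) x = onGhost (C.koszul x) := by
  have h : C.fintypeIndex = instFintypeSum (Fin l) (Root 𝔱) := Subsingleton.elim _ _
  simp only [koszul, onGhost_smul, onGhost_sum, onGhost_mul]
  rw [coad_apply, h, ← neg_one_smul ℂ]
  rfl

lemma normalDiff_rootBasis (P : Finset (Module.Dual ℂ (cartan 𝔱))) :
    (C.rootBasis hab).normalDiff (A := Module.End ℂ (Cochain 𝔤 V)) (wedgeOp 𝔤 V)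
      (contractOp 𝔤 V) P = onGhost (C.ghostDiff P) := by
  simp only [ghostDiff, onGhost_smul, onGhost_add, onGhost_sum, onGhost_mul,
    RootBasis.normalDiff, coad_rootBasis, cartanGhost_rootBasis]
  rfl

end ChevalleyBasis

namespace System

variable (S : System 𝔱 l V)
  (hab : ∀ h h' : cartan 𝔱, ⁅(h : ℂ ⊗[ℝ] 𝔤), (h' : ℂ ⊗[ℝ] 𝔤)⁆ = 0)

lemma shifted_repOp (x : ℂ ⊗[ℝ] 𝔤) :
    RootBasis.shifted (A := Module.End ℂ (Cochain 𝔤 V)) S.χ (repOp S.ρ) x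
      = TensorProduct.map LinearMap.id (S.constraint x) := by
  refine TensorProduct.ext' fun ψ v => ?_
  rw [RootBasis.shifted, constraint, map_tmul, LinearMap.sub_apply, LinearMap.sub_apply, tmul_sub,
    LinearMap.smul_apply, LinearMap.smul_apply, tmul_smul]
  rfl

lemma cartanTotal_rootBasis (h : cartan 𝔱) :
    (S.C.rootBasis hab).cartanTotal (A := Module.End ℂ (Cochain 𝔤 V)) (wedgeOp 𝔤 V)
      (contractOp 𝔤 V) S.P S.χ (repOp S.ρ) h = S.totalCartan h := by
  rw [RootBasis.cartanTotal, S.C.cartanGhost_rootBasis hab, totalCartan]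
  exact congrArg (· + onGhost (S.C.ghostCartan S.P h)) (S.shifted_repOp _)

variable [Module.Finite ℝ 𝔤] [Fintype (Root 𝔱)]

lemma totalDiff_rootBasis :
    (S.C.rootBasis hab).totalDiff (A := Module.End ℂ (Cochain 𝔤 V)) (wedgeOp 𝔤 V)
      (contractOp 𝔤 V) S.P S.χ (repOp S.ρ) = S.D := by
  have h : ∀ (a : Module.End ℂ (Ghost 𝔤)) (x : ℂ ⊗[ℝ] 𝔤),
      TensorProduct.map a (S.constraint x) = onGhost (V := V) a *
        RootBasis.shifted (A := Module.End ℂ (Cochain 𝔤 V)) S.χ (repOp S.ρ) x := fun a x => by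
    rw [S.shifted_repOp]
    exact TensorProduct.ext' fun ψ v => rfl
  rw [RootBasis.totalDiff, S.C.normalDiff_rootBasis hab]
  simp only [D, h]
  rfl

end System

/-! ### The vanishing of the cohomology -/

namespace ChevalleyBasis

variable (C : ChevalleyBasis 𝔱 l)

lemma two_rho_coroot_nonneg [Module.Finite ℝ 𝔤] [𝔱.IsCartanSubalgebra]
    (hcompact : ∀ x : 𝔤, x ≠ 0 → killingForm ℝ 𝔤 x x < 0)
    {P : Finset (Module.Dual ℂ (cartan 𝔱))} (hP : IsPositiveSystem 𝔱 P)
    {α : Module.Dual ℂ (cartan 𝔱)} (hα : α ∈ P) :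
    ∃ s : ℝ, 0 ≤ s ∧ (∑ β ∈ P, β) (C.coroot α) = s := by
  have hinv : ∀ x y z : ℂ ⊗[ℝ] 𝔤, (killingForm ℝ 𝔤).baseChange ℂ ⁅x, y⁆ z
      = -(killingForm ℝ 𝔤).baseChange ℂ y ⁅x, z⁆ := fun x y z => by
    have h := LieModule.traceForm_apply_lie_apply' ℂ (ℂ ⊗[ℝ] 𝔤) (ℂ ⊗[ℝ] 𝔤) x y z
    rw [LieModule.traceForm_baseChange] at h
    exact h
  rw [LinearMap.sum_apply]
  refine (C.rootBasis (lie_cartan_cartan hcompact 𝔱)).sum_apply_coroot_nonneg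
    hP.isPositiveChoice hα fun γ hγ => ?_
  exact (C.rootBasis (lie_cartan_cartan hcompact 𝔱)).stringCoeff_nonneg
    ((killingForm ℝ 𝔤).baseChange ℂ) (conj 𝔤) hinv conj_lie C.conj_rootVector
    (fun x hx => killingForm_conj_neg hcompact hx) (hP.isRoot α hα) hγ

end ChevalleyBasis

namespace System

variable (S : System 𝔱 l V) [Module.Finite ℝ 𝔤] [𝔱.IsCartanSubalgebra]

/-- The anomaly coefficients `r_α` are positive, and they are the values of `χ + 2ϱ` on the
coroots. -/
lemma anomaly_pos (hcompact : ∀ x : 𝔤, x ≠ 0 → killingForm ℝ 𝔤 x x < 0)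
    (hS : S.IsRegularDominant) {α : Module.Dual ℂ (cartan 𝔱)} (hα : α ∈ S.P) :
    0 < S.C.anomaly S.P S.χ α ∧
      S.χ (S.C.coroot α : ℂ ⊗[ℝ] 𝔤) + (∑ β ∈ S.P, β) (S.C.coroot α)
        = S.C.anomaly S.P S.χ α := by
  obtain ⟨s, hs, hs'⟩ := S.C.two_rho_coroot_nonneg hcompact hS.positive hα
  have h1 : S.C.anomaly S.P S.χ α = (S.χ (S.C.coroot α : ℂ ⊗[ℝ] 𝔤)).re + s := by
    rw [ChevalleyBasis.anomaly, if_pos hα, one_mul, hs', Complex.add_re, Complex.ofReal_re]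
  rw [h1, hs']
  refine ⟨by linarith [hS.χ_pos α hα], Complex.ext ?_ ?_⟩
  · simp
  · simp [hS.χ_real α hα]

/-- Every relative cocycle of positive ghost number is a relative coboundary. -/
lemma Zrel_le_Brel (hcompact : ∀ x : 𝔤, x ≠ 0 → killingForm ℝ 𝔤 x x < 0)
    (hS : S.IsRegularDominant) {r : ℤ} (hr : 0 < r) : S.Zrel r ≤ S.Brel r := by
  have hab := lie_cartan_cartan hcompact 𝔱
  have := S.C.finite_root
  have : Fintype (Root 𝔱) := Fintype.ofFinite _
  set R := S.C.rootBasis hab with hR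
  have hP := hS.positive.isPositiveChoice
  rintro Ψ ⟨⟨⟨hA, hrel⟩, hgh⟩, hD⟩
  obtain ⟨hT, hI⟩ := hrel
  have hne : ∀ α ∈ S.P, (S.χ + R.twoRho S.P) ((cartan 𝔱).subtype (R.coroot α)) ≠ 0 :=
    fun α hα => by
      obtain ⟨h1, h2⟩ := S.anomaly_pos hcompact hS hα
      rw [LinearMap.add_apply, R.twoRho_incl hP, ← LinearMap.sum_apply]
      rw [show S.χ ((cartan 𝔱).subtype (R.coroot α)) + (∑ β ∈ S.P, β) (R.coroot α)
        = S.C.anomaly S.P S.χ α from h2]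
      exact_mod_cast h1.ne'
  have hχ : ∀ α, S.χ (R.vec α) = 0 := fun α => by
    by_cases hα : IsRoot 𝔱 α
    · exact hS.χ_root α hα
    · rw [R.vec_of_not hα, map_zero]
  have key := R.exists_primitive (M := Cochain 𝔤 V) (isGhostRep V hS.map_lie) hP hχ hne
    (r := (r : ℂ)) (by exact_mod_cast hr.ne') (Ψ := Ψ)
  rw [S.totalDiff_rootBasis hab, S.C.relNumber_rootBasis hab] at key
  obtain ⟨Φ, h1, h2, h3, h4, h5⟩ := key hD
    (fun h => by rw [S.cartanTotal_rootBasis hab]; exact (Submodule.mem_iInf _).mp hT h)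
    (fun i => (Submodule.mem_iInf _).mp hI i) (Module.End.mem_eigenspace_iff.mp hgh)
  have h2' : ∀ h, S.totalCartan h Φ = 0 := fun h => by
    rw [← S.cartanTotal_rootBasis hab]; exact h2 h
  refine ⟨Φ, ⟨⟨h1, (Submodule.mem_iInf _).mpr h2', (Submodule.mem_iInf _).mpr h3⟩, ?_⟩, h5⟩
  refine Module.End.mem_eigenspace_iff.mpr ?_
  rw [h4]
  push_cast
  rfl

end System

end Translation

/-! ### Exterior monomials -/

section Monomials

/-- The number operator `v_k ∧ d⌋` of a factor `v_k` measures whether `v_k` occurs in an exterior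
product. -/
lemma ι_mul_contractLeft_prod {R M I : Type*} [CommRing R] [AddCommGroup M] [Module R M]
    [DecidableEq I] (v : I → M) (d : Module.Dual R M) {k : I} (hk : d (v k) = 1)
    (hd : ∀ j, j ≠ k → d (v j) = 0) (s : List I) :
    ExteriorAlgebra.ι R (v k) * CliffordAlgebra.contractLeft (Q := 0) d
        (s.map fun j => ExteriorAlgebra.ι R (v j)).prod
      = if k ∈ s then (s.map fun j => ExteriorAlgebra.ι R (v j)).prod else 0 := by
  induction s with
  | nil =>
    rw [List.map_nil, List.prod_nil]
    -- The units of the exterior and of the Clifford algebra agree by definition only.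
    erw [CliffordAlgebra.contractLeft_one]
    simp
  | cons j s ih =>
    have h : CliffordAlgebra.contractLeft (Q := 0) d (ExteriorAlgebra.ι R (v j) *
        (s.map fun j => ExteriorAlgebra.ι R (v j)).prod) =
        d (v j) • (s.map fun j => ExteriorAlgebra.ι R (v j)).prod - ExteriorAlgebra.ι R (v j) *
          CliffordAlgebra.contractLeft (Q := 0) d
            (s.map fun j => ExteriorAlgebra.ι R (v j)).prod :=
      CliffordAlgebra.contractLeft_ι_mul _ _ _
    rw [List.map_cons, List.prod_cons, h, mul_sub, ← mul_assoc]
    by_cases hj : j = k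
    · subst hj
      rw [ExteriorAlgebra.ι_sq_zero, zero_mul, sub_zero, hk, one_smul, if_pos List.mem_cons_self]
    · have hs := eq_neg_of_add_eq_zero_left (ExteriorAlgebra.ι_add_mul_swap (R := R) (v k) (v j))
      have hmem : k ∈ j :: s ↔ k ∈ s := by simp [Ne.symm hj]
      rw [hd j hj, zero_smul, mul_zero, zero_sub, hs, neg_mul, neg_neg, mul_assoc, ih]
      simp only [hmem, mul_ite, mul_zero]

variable {𝔤 : Type*} [LieRing 𝔤] [LieAlgebra ℝ 𝔤]

lemma wedge_wedge (θ : Module.Dual ℂ (ℂ ⊗[ℝ] 𝔤)) (ψ : Ghost 𝔤) :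
    wedge θ (wedge θ ψ) = 0 := by
  change ExteriorAlgebra.ι ℂ θ * (ExteriorAlgebra.ι ℂ θ * ψ) = 0
  rw [← mul_assoc, ExteriorAlgebra.ι_sq_zero, zero_mul]

lemma contract_contract (x : ℂ ⊗[ℝ] 𝔤) (ψ : Ghost 𝔤) : contract x (contract x ψ) = 0 :=
  CliffordAlgebra.contractLeft_contractLeft _ _

lemma wedge_contract_add (θ : Module.Dual ℂ (ℂ ⊗[ℝ] 𝔤)) (x : ℂ ⊗[ℝ] 𝔤) (ψ : Ghost 𝔤) :
    wedge θ (contract x ψ) + contract x (wedge θ ψ) = θ x • ψ := by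
  have h : contract x (wedge θ ψ) = θ x • ψ - wedge θ (contract x ψ) :=
    CliffordAlgebra.contractLeft_ι_mul _ _ _
  rw [h, add_sub_cancel]

namespace ChevalleyBasis

variable {𝔱 : LieSubalgebra ℝ 𝔤} {l : ℕ} [Module.Finite ℝ 𝔤] (C : ChevalleyBasis 𝔱 l)

open Classical in
lemma wedge_contract_monomials (k : Fin l ⊕ Root 𝔱) (s : Finset (Fin l ⊕ Root 𝔱)) :
    wedge (C.basis.coord k) (contract (C.basis k) (C.monomials s))
      = if k ∈ s then C.monomials s else 0 := by
  let := C.orderIndex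
  have := Module.Finite.finite_basis C.basis
  set f : Fin s.card ↪o (Fin l ⊕ Root 𝔱) := Set.powersetCard.ofFinEmbEquiv.symm
    (Set.powersetCard.prodEquiv.symm s).2 with hf
  have hmem : k ∈ List.ofFn f ↔ k ∈ s := by
    rw [List.mem_ofFn, ← Set.mem_range, hf]
    exact Set.powersetCard.mem_range_ofFinEmbEquiv_symm_iff_mem _ _
  have hm : C.monomials s
      = ((List.ofFn f).map fun j => ExteriorAlgebra.ι ℂ (C.basis.coord j)).prod := by
    rw [List.map_ofFn]
    refine (ExteriorAlgebra.basis_apply _ s).trans ?_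
    refine (ExteriorAlgebra.ιMulti_apply _).trans ?_
    simp only [Module.Basis.coe_dualBasis]
    rfl
  have key := ι_mul_contractLeft_prod (fun j => C.basis.coord j)
    (Module.Dual.eval ℂ (ℂ ⊗[ℝ] 𝔤) (C.basis k)) (k := k) (by simp)
    (fun j hj => by simp [Ne.symm hj]) (List.ofFn f)
  rw [← hm] at key
  simp only [hmem] at key
  exact key

variable {k : Fin l ⊕ Root 𝔱} {s : Finset (Fin l ⊕ Root 𝔱)}

lemma wedge_monomials_of_mem (hk : k ∈ s) : wedge (C.basis.coord k) (C.monomials s) = 0 := by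
  have h := C.wedge_contract_monomials k s
  rw [if_pos hk] at h
  rw [← h, wedge_wedge]

lemma contract_wedge_monomials (k : Fin l ⊕ Root 𝔱) (s : Finset (Fin l ⊕ Root 𝔱))
    [Decidable (k ∈ s)] :
    contract (C.basis k) (wedge (C.basis.coord k) (C.monomials s))
      = if k ∈ s then 0 else C.monomials s := by
  have h := wedge_contract_add (C.basis.coord k) (C.basis k) (C.monomials s)
  rw [C.wedge_contract_monomials] at h
  rw [Module.Basis.coord_apply, Module.Basis.repr_self, Finsupp.single_eq_same, one_smul] at h
  by_cases hk : k ∈ s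
  · rw [if_pos hk] at h ⊢
    exact left_eq_add.mp (h.symm)
  · rw [if_neg hk] at h ⊢
    rwa [zero_add] at h

lemma contract_monomials_of_notMem (hk : k ∉ s) :
    contract (C.basis k) (C.monomials s) = 0 := by
  classical
  have h := C.contract_wedge_monomials k s
  rw [if_neg hk] at h
  rw [← h, contract_contract]

open Classical in
lemma coord_wedge_contract (k : Fin l ⊕ Root 𝔱) (s : Finset (Fin l ⊕ Root 𝔱)) (ψ : Ghost 𝔤) :
    C.monomials.coord s (wedge (C.basis.coord k) (contract (C.basis k) ψ))
      = if k ∈ s then C.monomials.coord s ψ else 0 := by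
  have h : C.monomials.coord s ∘ₗ (wedge (C.basis.coord k) ∘ₗ contract (C.basis k))
      = (if k ∈ s then 1 else 0 : ℂ) • C.monomials.coord s := by
    refine C.monomials.ext fun t => ?_
    rw [LinearMap.comp_apply, LinearMap.comp_apply, C.wedge_contract_monomials,
      LinearMap.smul_apply]
    by_cases hst : t = s
    · subst hst
      split_ifs <;> simp
    · split_ifs <;> simp [hst]
  have h' := LinearMap.congr_fun h ψ
  rw [LinearMap.smul_apply, LinearMap.comp_apply, LinearMap.comp_apply] at h'
  rw [h']
  split_ifs <;> simp

lemma coord_wedge_of_notMem (hk : k ∉ s) (ψ : Ghost 𝔤) :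
    C.monomials.coord s (wedge (C.basis.coord k) ψ) = 0 := by
  have h := wedge_contract_add (C.basis.coord k) (C.basis k) (wedge (C.basis.coord k) ψ)
  rw [wedge_wedge, map_zero, add_zero, Module.Basis.coord_apply, Module.Basis.repr_self,
    Finsupp.single_eq_same, one_smul] at h
  rw [← h, C.coord_wedge_contract, if_neg hk]

lemma coord_contract_of_mem (hk : k ∈ s) (ψ : Ghost 𝔤) :
    C.monomials.coord s (contract (C.basis k) ψ) = 0 := by
  have h := C.coord_wedge_contract k s (contract (C.basis k) ψ)
  rw [contract_contract, map_zero, map_zero, if_pos hk] at h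
  exact h.symm

end ChevalleyBasis

end Monomials

/-! ### The vacuum of the ghost sector -/

section VacuumSector

variable {𝔤 : Type*} [LieRing 𝔤] [LieAlgebra ℝ 𝔤]
  {𝔱 : LieSubalgebra ℝ 𝔤} {l : ℕ} {V : Type*} [NormedAddCommGroup V] [InnerProductSpace ℂ V]

namespace ChevalleyBasis

variable (C : ChevalleyBasis 𝔱 l)

lemma c_eq {α : Module.Dual ℂ (cartan 𝔱)} (hα : IsRoot 𝔱 (-α)) :
    C.c α = wedge (C.basis.coord (Sum.inr ⟨-α, hα⟩)) := by
  rw [c, θ, dif_pos hα]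

lemma b_eq {α : Module.Dual ℂ (cartan 𝔱)} (hα : IsRoot 𝔱 α) :
    C.b α = contract (C.basis (Sum.inr ⟨α, hα⟩)) := by
  rw [b, τ, rootVector, dif_pos hα]

lemma c_neg_eq {α : Module.Dual ℂ (cartan 𝔱)} (hα : IsRoot 𝔱 α) :
    C.c (-α) = wedge (C.basis.coord (Sum.inr ⟨α, hα⟩)) := by
  have h : IsRoot 𝔱 (- -α) := (neg_neg α).symm ▸ hα
  rw [C.c_eq h]
  congr 4
  exact neg_neg α

variable [Module.Finite ℝ 𝔤]

open Classical in
/-- The labels of the factors of the ghost vacuum. -/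
def vacuumLabels (P : Finset (Module.Dual ℂ (cartan 𝔱))) : Finset (Fin l ⊕ Root 𝔱) :=
  letI := C.fintypeIndex
  {k | ∃ β : Root 𝔱, k = Sum.inr β ∧ -β.1 ∈ P}

variable (P : Finset (Module.Dual ℂ (cartan 𝔱)))

lemma vacuum_eq : C.vacuum P = C.monomials (C.vacuumLabels P) := rfl

lemma inl_notMem_vacuumLabels (i : Fin l) : Sum.inl i ∉ C.vacuumLabels P := by
  let := C.fintypeIndex
  simp [vacuumLabels]

lemma inr_mem_vacuumLabels (β : Root 𝔱) : Sum.inr β ∈ C.vacuumLabels P ↔ -β.1 ∈ P := by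
  let := C.fintypeIndex
  simp only [vacuumLabels, Finset.mem_filter_univ, Sum.inr.injEq]
  exact ⟨fun ⟨γ, h, h'⟩ => h ▸ h', fun h => ⟨β, rfl, h⟩⟩

open Classical in
lemma coord_ghBar (hP : IsPositiveSystem 𝔱 P) (s : Finset (Fin l ⊕ Root 𝔱)) (ψ : Ghost 𝔤) :
    C.monomials.coord s (C.ghBar P ψ)
      = (({α ∈ P | ∃ h : IsRoot 𝔱 α, Sum.inr ⟨α, h⟩ ∈ s} : Finset _).card : ℂ)
        • C.monomials.coord s ψ := by
  rw [ghBar, LinearMap.sum_apply, map_sum, Finset.card_filter, Nat.cast_sum, Finset.sum_smul]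
  refine Finset.sum_congr rfl fun α hα => ?_
  have hr := hP.isRoot α hα
  rw [Module.End.mul_apply, C.c_neg_eq hr, C.b_eq hr, C.coord_wedge_contract]
  by_cases h : (Sum.inr ⟨α, hr⟩ : Fin l ⊕ Root 𝔱) ∈ s
  · rw [if_pos h, if_pos ⟨hr, h⟩, Nat.cast_one, one_smul]
  · rw [if_neg h, if_neg fun ⟨_, h'⟩ => h h', Nat.cast_zero, zero_smul]

open Classical in
lemma coord_gh (hP : IsPositiveSystem 𝔱 P) (s : Finset (Fin l ⊕ Root 𝔱)) (ψ : Ghost 𝔤) :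
    C.monomials.coord s (C.gh P ψ)
      = (({α ∈ P | ∃ h : IsRoot 𝔱 (-α), Sum.inr ⟨-α, h⟩ ∉ s} : Finset _).card : ℂ)
        • C.monomials.coord s ψ := by
  rw [gh, LinearMap.sum_apply, map_sum, Finset.card_filter, Nat.cast_sum, Finset.sum_smul]
  refine Finset.sum_congr rfl fun α hα => ?_
  have hr := C.isRoot_neg (hP.isRoot α hα)
  have h1 := wedge_contract_add (C.basis.coord (Sum.inr ⟨-α, hr⟩)) (C.basis (Sum.inr ⟨-α, hr⟩)) ψ
  rw [Module.Basis.coord_apply, Module.Basis.repr_self, Finsupp.single_eq_same, one_smul] at h1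
  have h2 := congrArg (C.monomials.coord s) h1
  rw [map_add, C.coord_wedge_contract] at h2
  rw [Module.End.mul_apply, C.c_eq hr, C.b_eq hr]
  by_cases h : (Sum.inr ⟨-α, hr⟩ : Fin l ⊕ Root 𝔱) ∈ s
  · rw [if_pos h] at h2
    rw [if_neg fun ⟨_, h'⟩ => h' h, Nat.cast_zero, zero_smul]
    exact left_eq_add.mp h2.symm
  · rw [if_neg h, zero_add] at h2
    rw [if_pos ⟨hr, h⟩, Nat.cast_one, one_smul, h2]

end ChevalleyBasis

namespace System

variable (S : System 𝔱 l V) [Module.Finite ℝ 𝔤]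

lemma coeff_tmul (s : Finset (Fin l ⊕ Root 𝔱)) (ψ : Ghost 𝔤) (v : V) :
    S.coeff s (ψ ⊗ₜ v) = S.C.monomials.coord s ψ • v := rfl

lemma coeff_map (s : Finset (Fin l ⊕ Root 𝔱)) (f : Module.End ℂ V) (Ψ : Cochain 𝔤 V) :
    S.coeff s (TensorProduct.map LinearMap.id f Ψ) = f (S.coeff s Ψ) := by
  have h : S.coeff s ∘ₗ TensorProduct.map LinearMap.id f = f ∘ₗ S.coeff s :=
    TensorProduct.ext' fun ψ v => (map_smul f _ _).symm
  exact LinearMap.congr_fun h Ψ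

lemma coeff_onGhost {s : Finset (Fin l ⊕ Root 𝔱)} {a : Module.End ℂ (Ghost 𝔤)} {z : ℂ}
    (h : ∀ ψ, S.C.monomials.coord s (a ψ) = z • S.C.monomials.coord s ψ) (Ψ : Cochain 𝔤 V) :
    S.coeff s (onGhost a Ψ) = z • S.coeff s Ψ := by
  have h : S.coeff s ∘ₗ onGhost a = z • S.coeff s := TensorProduct.ext' fun ψ v => by
    rw [LinearMap.comp_apply, map_tmul, coeff_tmul, h, LinearMap.smul_apply, coeff_tmul,
      LinearMap.id_apply, smul_assoc]
  exact LinearMap.congr_fun h Ψ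

lemma coeff_onGhost_eq_zero {s : Finset (Fin l ⊕ Root 𝔱)} {a : Module.End ℂ (Ghost 𝔤)}
    (h : ∀ ψ, S.C.monomials.coord s (a ψ) = 0) (Ψ : Cochain 𝔤 V) :
    S.coeff s (onGhost a Ψ) = 0 := by
  rw [S.coeff_onGhost (z := 0) (fun ψ => by rw [h, zero_smul]), zero_smul]

lemma ext_coeff {Ψ Φ : Cochain 𝔤 V} (h : ∀ s, S.coeff s Ψ = S.coeff s Φ) : Ψ = Φ := by
  classical
  have h1 : ∀ s Ψ, TensorProduct.equivFinsuppOfBasisLeft (N := V) S.C.monomials Ψ s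
      = S.coeff s Ψ := fun s Ψ => by
    have : (Finsupp.lapply s : (Finset (Fin l ⊕ Root 𝔱) →₀ V) →ₗ[ℂ] V) ∘ₗ
        (TensorProduct.equivFinsuppOfBasisLeft (N := V) S.C.monomials).toLinearMap = S.coeff s :=
      TensorProduct.ext' fun ψ v => by
        rw [coeff_tmul, LinearMap.comp_apply, LinearEquiv.coe_coe, Finsupp.lapply_apply,
          TensorProduct.equivFinsuppOfBasisLeft_apply_tmul_apply]
        rfl
    exact LinearMap.congr_fun this Ψ
  refine (TensorProduct.equivFinsuppOfBasisLeft (N := V) S.C.monomials).injective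
    (Finsupp.ext fun s => ?_)
  rw [h1, h1, h]

lemma coeff_vacuum_tmul (φ : V) :
    S.coeff (S.C.vacuumLabels S.P) (S.C.vacuum S.P ⊗ₜ φ) = φ := by
  rw [coeff_tmul, S.C.vacuum_eq, Module.Basis.coord_apply, Module.Basis.repr_self,
    Finsupp.single_eq_same, one_smul]

lemma coeff_vacuum_tmul_of_ne {s : Finset (Fin l ⊕ Root 𝔱)} (hs : s ≠ S.C.vacuumLabels S.P)
    (φ : V) : S.coeff s (S.C.vacuum S.P ⊗ₜ φ) = 0 := by
  rw [coeff_tmul, S.C.vacuum_eq, Module.Basis.coord_apply, Module.Basis.repr_self,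
    Finsupp.single_eq_of_ne hs, zero_smul]

variable {S}

lemma isVacuum_tmul (hP : IsPositiveSystem 𝔱 S.P)
    (hab : ∀ h h' : cartan 𝔱, ⁅(h : ℂ ⊗[ℝ] 𝔤), (h' : ℂ ⊗[ℝ] 𝔤)⁆ = 0) (φ : V) :
    (S.C.rootBasis hab).IsVacuum (wedgeOp 𝔤 V) (contractOp 𝔤 V) S.P (S.C.vacuum S.P ⊗ₜ φ) where
  ghost_eq_zero α hα := by
    have hr := S.C.isRoot_neg (hP.isRoot α hα)
    have h : S.C.c α (S.C.vacuum S.P) = 0 := by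
      rw [S.C.c_eq hr, S.C.vacuum_eq]
      refine S.C.wedge_monomials_of_mem ?_
      rw [S.C.inr_mem_vacuumLabels, neg_neg]
      exact hα
    rw [S.C.ghost_rootBasis hab, map_tmul, h, zero_tmul]
  antighost_eq_zero α hα := by
    have hr := hP.isRoot α hα
    have h : S.C.b α (S.C.vacuum S.P) = 0 := by
      rw [S.C.b_eq hr, S.C.vacuum_eq]
      refine S.C.contract_monomials_of_notMem ?_
      rw [S.C.inr_mem_vacuumLabels]
      exact hP.neg_notMem α hα
    rw [S.C.antighost_rootBasis hab, map_tmul, h, zero_tmul]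
  incl_eq_zero h := by
    have := S.C.finite_root
    have : Fintype (Root 𝔱) := Fintype.ofFinite _
    rw [← (S.C.rootBasis hab).sum_coord_inl h, map_sum, LinearMap.sum_apply]
    refine Finset.sum_eq_zero fun i _ => ?_
    have h0 : contractOp 𝔤 V (S.C.cartanVec i : ℂ ⊗[ℝ] 𝔤) (S.C.vacuum S.P ⊗ₜ φ) = 0 := by
      rw [contractOp_tmul, ← S.C.basis_inl, S.C.vacuum_eq,
        S.C.contract_monomials_of_notMem (S.C.inl_notMem_vacuumLabels S.P i), zero_tmul]
    rw [map_smul, LinearMap.smul_apply]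
    exact (congrArg _ h0).trans (smul_zero _)

lemma isCovacuum_coeff (hP : IsPositiveSystem 𝔱 S.P)
    (hab : ∀ h h' : cartan 𝔱, ⁅(h : ℂ ⊗[ℝ] 𝔤), (h' : ℂ ⊗[ℝ] 𝔤)⁆ = 0) :
    (S.C.rootBasis hab).IsCovacuum (wedgeOp 𝔤 V) (contractOp 𝔤 V) S.P
      (S.coeff (S.C.vacuumLabels S.P)) where
  apply_ghost α hα Φ := by
    have hr := hP.isRoot α hα
    rw [S.C.ghost_rootBasis hab, S.C.c_neg_eq hr]
    refine S.coeff_onGhost_eq_zero (fun ψ => S.C.coord_wedge_of_notMem ?_ ψ) Φ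
    rw [S.C.inr_mem_vacuumLabels]
    exact hP.neg_notMem α hα
  apply_antighost α hα Φ := by
    have hr := S.C.isRoot_neg (hP.isRoot α hα)
    rw [S.C.antighost_rootBasis hab, S.C.b_eq hr]
    refine S.coeff_onGhost_eq_zero (fun ψ => S.C.coord_contract_of_mem ?_ ψ) Φ
    rw [S.C.inr_mem_vacuumLabels, neg_neg]
    exact hα
  apply_cartan i Φ :=
    S.coeff_onGhost_eq_zero
      (fun ψ => S.C.coord_wedge_of_notMem (S.C.inl_notMem_vacuumLabels S.P i) ψ) Φ

/-- The relative cochains of bidegree `(0, 0)` are the `ω ⊗ φ`. -/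
lemma eq_vacuum_tmul (hP : IsPositiveSystem 𝔱 S.P) {Ψ : Cochain 𝔤 V}
    (hb : ∀ i, onGhost (V := V) (S.C.bCartan i) Ψ = 0)
    (hbar : onGhost (V := V) (S.C.ghBar S.P) Ψ = 0) (hgh : onGhost (V := V) (S.C.gh S.P) Ψ = 0) :
    Ψ = S.C.vacuum S.P ⊗ₜ S.coeff (S.C.vacuumLabels S.P) Ψ := by
  classical
  refine S.ext_coeff fun s => ?_
  by_cases hs : s = S.C.vacuumLabels S.P
  · rw [hs, coeff_vacuum_tmul]
  rw [S.coeff_vacuum_tmul_of_ne hs]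
  by_contra h0
  have h1 := S.coeff_onGhost (S.C.coord_ghBar S.P hP s) Ψ
  have h2 := S.coeff_onGhost (S.C.coord_gh S.P hP s) Ψ
  rw [hbar, map_zero, eq_comm, smul_eq_zero_iff_left h0, Nat.cast_eq_zero, Finset.card_eq_zero,
    Finset.filter_eq_empty_iff] at h1
  rw [hgh, map_zero, eq_comm, smul_eq_zero_iff_left h0, Nat.cast_eq_zero, Finset.card_eq_zero,
    Finset.filter_eq_empty_iff] at h2
  -- A monomial with all the negative factors, no positive ones and no `θ^i` is `ω`.
  refine hs (Finset.ext fun k => ?_)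
  rcases k with i | β
  · refine iff_of_false (fun hi => h0 ?_) (S.C.inl_notMem_vacuumLabels S.P i)
    have h3 := S.coeff_onGhost (V := V) (s := s) (z := 1)
      (a := wedge (S.C.basis.coord (Sum.inl i)) * S.C.bCartan i) (fun ψ => by
        rw [Module.End.mul_apply, ChevalleyBasis.bCartan, ← S.C.basis_inl,
          S.C.coord_wedge_contract, if_pos hi, one_smul]) Ψ
    rw [onGhost_mul, Module.End.mul_apply, hb, map_zero, map_zero, one_smul] at h3
    exact h3.symm
  · rw [S.C.inr_mem_vacuumLabels]
    rcases hP.mem_or_neg_mem β.1 β.2 with hβ | hβ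
    · exact iff_of_false (fun h => h1 hβ ⟨β.2, h⟩) (hP.neg_notMem _ hβ)
    · refine iff_of_true (by_contra fun h => h2 hβ ⟨S.C.isRoot_neg (hP.isRoot _ hβ), ?_⟩) hβ
      intro h'
      refine h ?_
      convert h'
      exact (neg_neg β.1).symm

end System

end VacuumSector

/-! ### The skew action and the Borel invariants -/

section Harmonic

variable {𝔤 : Type*} [LieRing 𝔤] [LieAlgebra ℝ 𝔤]
  {𝔱 : LieSubalgebra ℝ 𝔤} {l : ℕ} {V : Type*} [NormedAddCommGroup V] [InnerProductSpace ℂ V]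

namespace System

variable {S : System 𝔱 l V}

lemma inner_liftBaseChange (hskew : ∀ (x : 𝔤) (u v : V), inner ℂ (S.ρ x u) v = -inner ℂ u (S.ρ x v))
    (x : ℂ ⊗[ℝ] 𝔤) (u v : V) :
    inner ℂ u (S.ρ.liftBaseChange ℂ x v) = -inner ℂ (S.ρ.liftBaseChange ℂ (conj 𝔤 x) u) v := by
  induction x using TensorProduct.induction_on with
  | zero => simp
  | add x y hx hy =>
    simp only [map_add, LinearMap.add_apply, inner_add_left, inner_add_right, hx, hy, neg_add]
  | tmul z x =>
    rw [conj_tmul, LinearMap.liftBaseChange_tmul, LinearMap.liftBaseChange_tmul,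
      LinearMap.smul_apply, LinearMap.smul_apply, inner_smul_left, inner_smul_right, hskew,
      Complex.conj_conj, mul_neg, neg_neg]

lemma inner_constraint_neg (hS : S.IsRegularDominant) {α : Module.Dual ℂ (cartan 𝔱)}
    (hα : IsRoot 𝔱 α) (u v : V) :
    inner ℂ u (S.constraint (S.C.τ (-α)) v) = -inner ℂ (S.constraint (S.C.τ α) u) v := by
  have h : conj 𝔤 (S.C.τ (-α)) = S.C.τ α := by
    have h := S.C.conj_rootVector (-α) (S.C.isRoot_neg hα)
    rwa [neg_neg] at h
  rw [constraint, constraint, hS.χ_root α hα, hS.χ_root (-α) (S.C.isRoot_neg hα), zero_smul,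
    sub_zero, sub_zero, inner_liftBaseChange hS.skew, h]

lemma mem_borelInvariants {φ : V} : φ ∈ S.borelInvariants ↔
    (∀ α ∈ S.P, S.constraint (S.C.τ α) φ = 0) ∧
      ∀ h : cartan 𝔱, S.constraint (h : ℂ ⊗[ℝ] 𝔤) φ = 0 := by
  simp only [borelInvariants, Submodule.mem_inf, Submodule.mem_iInf, LinearMap.mem_ker]

variable [Module.Finite ℝ 𝔤]

/-! ### The Kähler pairing -/

lemma pairing_conj_symm (Ψ Φ : Cochain 𝔤 V) :
    starRingEnd ℂ (S.pairing Ψ Φ) = S.pairing Φ Ψ := by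
  simp [pairing, map_sum]

lemma pairing_add_right (Ψ Φ Φ' : Cochain 𝔤 V) :
    S.pairing Ψ (Φ + Φ') = S.pairing Ψ Φ + S.pairing Ψ Φ' := by
  simp only [pairing, map_add, inner_add_right, mul_add, Finset.sum_add_distrib]

lemma pairing_vacuum_tmul (φ : V) (Φ : Cochain 𝔤 V) :
    S.pairing (S.C.vacuum S.P ⊗ₜ φ) Φ
      = S.C.weight S.P S.χ (S.C.vacuumLabels S.P)
        * inner ℂ φ (S.coeff (S.C.vacuumLabels S.P) Φ) := by
  rw [pairing, Finset.sum_eq_single (S.C.vacuumLabels S.P), coeff_vacuum_tmul]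
  · intro s _ hs
    rw [S.coeff_vacuum_tmul_of_ne hs, inner_zero_left, mul_zero]
  · exact fun h => absurd (@Finset.mem_univ _ (@Finset.fintype _ S.C.fintypeIndex) _) h

lemma weight_pos [𝔱.IsCartanSubalgebra]
    (hcompact : ∀ x : 𝔤, x ≠ 0 → killingForm ℝ 𝔤 x x < 0)
    (hS : S.IsRegularDominant) (s : Finset (Fin l ⊕ Root 𝔱)) : 0 < S.C.weight S.P S.χ s := by
  have hpos : ∀ β : Root 𝔱, 0 < S.C.anomaly S.P S.χ β.1 := fun β => by
    rcases hS.positive.mem_or_neg_mem β.1 β.2 with hβ | hβ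
    · exact (S.anomaly_pos hcompact hS hβ).1
    · have hβ' : β.1 ∉ S.P := fun h => hS.positive.neg_notMem _ h hβ
      have h1 : S.C.coroot (-β.1) = -S.C.coroot β.1 :=
        Subtype.ext ((S.C.rootBasis (lie_cartan_cartan hcompact 𝔱)).coroot_neg β.2)
      have h2 := (S.anomaly_pos hcompact hS hβ).1
      rw [ChevalleyBasis.anomaly, if_pos hβ, h1] at h2
      rw [ChevalleyBasis.anomaly, if_neg hβ']
      simp only [NegMemClass.coe_neg, map_neg, Complex.add_re, Complex.neg_re] at h2 ⊢
      linarith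
  refine mul_pos (Finset.prod_pos fun k _ => ?_)
    (Finset.prod_pos fun α hα => (S.anomaly_pos hcompact hS hα).1)
  rcases k with i | β
  · exact one_pos
  · exact inv_pos.mpr (hpos β)

lemma re_inner_nonneg (v : V) : 0 ≤ (inner ℂ v v : ℂ).re := inner_self_nonneg (𝕜 := ℂ)

lemma pairing_self_nonneg [𝔱.IsCartanSubalgebra]
    (hcompact : ∀ x : 𝔤, x ≠ 0 → killingForm ℝ 𝔤 x x < 0)
    (hS : S.IsRegularDominant) (Ψ : Cochain 𝔤 V) : 0 ≤ (S.pairing Ψ Ψ).re := by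
  rw [pairing, Complex.re_sum]
  refine Finset.sum_nonneg fun s _ => ?_
  rw [Complex.re_ofReal_mul]
  exact mul_nonneg (weight_pos hcompact hS s).le (re_inner_nonneg _)

lemma eq_zero_of_pairing_self [𝔱.IsCartanSubalgebra]
    (hcompact : ∀ x : 𝔤, x ≠ 0 → killingForm ℝ 𝔤 x x < 0)
    (hS : S.IsRegularDominant) {Ψ : Cochain 𝔤 V} (h : (S.pairing Ψ Ψ).re = 0) : Ψ = 0 := by
  let := S.C.fintypeIndex
  rw [pairing, Complex.re_sum, Finset.sum_eq_zero_iff_of_nonneg] at h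
  · refine S.ext_coeff fun s => ?_
    have hs := h s (Finset.mem_univ s)
    rw [Complex.re_ofReal_mul, mul_eq_zero_iff_left (weight_pos hcompact hS s).ne'] at hs
    rw [map_zero]
    exact inner_self_eq_zero.mp (Complex.ext hs (inner_self_im (𝕜 := ℂ) _))
  · intro s _
    rw [Complex.re_ofReal_mul]
    exact mul_nonneg (weight_pos hcompact hS s).le (re_inner_nonneg _)

/-- Harmonic cochains are closed: pairing `Δ Ψ = 0` with `Ψ` gives `‖D† Ψ‖² + ‖D Ψ‖² = 0`. -/
lemma D_eq_zero_of_harmonic [𝔱.IsCartanSubalgebra]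
    (hcompact : ∀ x : 𝔤, x ≠ 0 → killingForm ℝ 𝔤 x x < 0)
    (hS : S.IsRegularDominant) {Ψ : Cochain 𝔤 V} (hΨ : Ψ ∈ S.harmonic) : S.D Ψ = 0 := by
  obtain ⟨⟨-, hrel⟩, Ξ, Υ, ⟨hΞ, h1⟩, ⟨-, h2⟩, h3⟩ := hΨ
  have h4 := congrArg Complex.re (pairing_add_right (S := S) Ψ (S.D Ξ) Υ)
  have h5 : (S.pairing Ψ Υ).re = (S.pairing (S.D Ψ) (S.D Ψ)).re := by
    rw [← h2 Ψ hrel, ← pairing_conj_symm Ψ Υ, Complex.conj_re]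
  have h0 : S.pairing Ψ 0 = 0 := by simp [pairing]
  rw [h3, h0, Complex.add_re, h5, ← h1 Ξ hΞ, Complex.zero_re] at h4
  have h6 := pairing_self_nonneg hcompact hS Ξ
  have h7 := pairing_self_nonneg hcompact hS (S.D Ψ)
  exact eq_zero_of_pairing_self hcompact hS (by linarith)

/-! ### The harmonic space of bidegree `(0, 0)` -/

/-- The normal ordering of `L_H` is such that `ω` has weight zero. -/
lemma totalCartan_vacuum_tmul (hS : S.IsRegularDominant)
    (hab : ∀ h h' : cartan 𝔱, ⁅(h : ℂ ⊗[ℝ] 𝔤), (h' : ℂ ⊗[ℝ] 𝔤)⁆ = 0) (h : cartan 𝔱) (φ : V) :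
    S.totalCartan h (S.C.vacuum S.P ⊗ₜ φ)
      = S.C.vacuum S.P ⊗ₜ S.constraint (h : ℂ ⊗[ℝ] 𝔤) φ := by
  have h1 := (isVacuum_tmul hS.positive hab φ).cartanGhost_eq_zero h
  rw [S.C.cartanGhost_rootBasis hab] at h1
  rw [totalCartan, LinearMap.add_apply, h1, add_zero]
  rfl

lemma D_vacuum_tmul (hS : S.IsRegularDominant)
    (hab : ∀ h h' : cartan 𝔱, ⁅(h : ℂ ⊗[ℝ] 𝔤), (h' : ℂ ⊗[ℝ] 𝔤)⁆ = 0) {φ : V}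
    (hφ : ∀ h : cartan 𝔱, S.constraint (h : ℂ ⊗[ℝ] 𝔤) φ = 0) :
    S.D (S.C.vacuum S.P ⊗ₜ φ)
      = ∑ α ∈ S.P, S.C.c (-α) (S.C.vacuum S.P) ⊗ₜ S.constraint (S.C.τ α) φ := by
  have := S.C.finite_root
  have : Fintype (Root 𝔱) := Fintype.ofFinite _
  have key := (S.C.rootBasis hab).totalDiff_vacuum (χ := S.χ) (isGhostRep V hS.map_lie)
    hS.positive.isPositiveChoice (isVacuum_tmul hS.positive hab φ) (fun h => by
      rw [S.shifted_repOp, map_tmul]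
      exact (congrArg _ (hφ h)).trans (tmul_zero _ _))
  rw [S.totalDiff_rootBasis hab] at key
  rw [key]
  refine Finset.sum_congr rfl fun α _ => ?_
  rw [S.shifted_repOp, S.C.ghost_rootBasis hab]
  rfl

lemma D_vacuum_tmul_eq_zero_iff (hS : S.IsRegularDominant)
    (hab : ∀ h h' : cartan 𝔱, ⁅(h : ℂ ⊗[ℝ] 𝔤), (h' : ℂ ⊗[ℝ] 𝔤)⁆ = 0) {φ : V}
    (hφ : ∀ h : cartan 𝔱, S.constraint (h : ℂ ⊗[ℝ] 𝔤) φ = 0) :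
    S.D (S.C.vacuum S.P ⊗ₜ φ) = 0 ↔ ∀ α ∈ S.P, S.constraint (S.C.τ α) φ = 0 := by
  rw [D_vacuum_tmul hS hab hφ]
  refine ⟨fun h α hα => ?_, fun h => Finset.sum_eq_zero fun α hα => by rw [h α hα, tmul_zero]⟩
  -- Substitution of `τ_α` extracts the term of `α`.
  have hr := hS.positive.isRoot α hα
  have h1 : ∀ β (hβ : β ∈ S.P), S.C.b α (S.C.c (-β) (S.C.vacuum S.P))
      = S.C.basis.coord (Sum.inr ⟨β, hS.positive.isRoot β hβ⟩)
          (S.C.basis (Sum.inr ⟨α, hr⟩)) • S.C.vacuum S.P := fun β hβ => by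
    rw [S.C.b_eq hr, S.C.c_neg_eq (hS.positive.isRoot β hβ), ← wedge_contract_add,
      S.C.vacuum_eq, S.C.contract_monomials_of_notMem, map_zero, zero_add]
    rw [S.C.inr_mem_vacuumLabels]
    exact hS.positive.neg_notMem α hα
  have h2 := congrArg (onGhost (V := V) (S.C.b α)) h
  rw [map_sum, map_zero, Finset.sum_eq_single α] at h2
  · rw [map_tmul, h1 α hα, Module.Basis.coord_apply, Module.Basis.repr_self,
      Finsupp.single_eq_same, one_smul, LinearMap.id_apply] at h2
    rw [← S.coeff_vacuum_tmul (S.constraint (S.C.τ α) φ), h2, map_zero]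
  · intro β hβ hne
    rw [map_tmul, h1 β hβ, Module.Basis.coord_apply, Module.Basis.repr_self,
      Finsupp.single_eq_of_ne, zero_smul, zero_tmul]
    simpa using hne
  · exact fun h' => absurd hα h'

/-- The coefficient of `D Φ` at the vacuum is a sum of values of the operators `ℒ_{-α}`, which are
adjoint to the `-ℒ_α`. -/
lemma pairing_vacuum_D (hS : S.IsRegularDominant)
    (hab : ∀ h h' : cartan 𝔱, ⁅(h : ℂ ⊗[ℝ] 𝔤), (h' : ℂ ⊗[ℝ] 𝔤)⁆ = 0) {φ : V}
    (hφ : ∀ α ∈ S.P, S.constraint (S.C.τ α) φ = 0) (Φ : Cochain 𝔤 V) :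
    S.pairing (S.C.vacuum S.P ⊗ₜ φ) (S.D Φ) = 0 := by
  have := S.C.finite_root
  have : Fintype (Root 𝔱) := Fintype.ofFinite _
  have key := (S.C.rootBasis hab).apply_totalDiff (χ := S.χ) (ρ := repOp S.ρ)
    (isGhostRep V hS.map_lie).toIsGhostPair
    hS.positive.isPositiveChoice (isCovacuum_coeff hS.positive hab) Φ
  rw [S.totalDiff_rootBasis hab] at key
  rw [pairing_vacuum_tmul, key, inner_sum, Finset.sum_eq_zero, mul_zero]
  intro α hα
  have h1 : ∀ Φ, onGhost (V := V) (S.C.c α)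
      (TensorProduct.map LinearMap.id (S.constraint (S.C.τ (-α))) Φ)
        = TensorProduct.map LinearMap.id (S.constraint (S.C.τ (-α)))
          (onGhost (V := V) (S.C.c α) Φ) := fun Φ => by
    have h : onGhost (V := V) (S.C.c α) ∘ₗ
        TensorProduct.map LinearMap.id (S.constraint (S.C.τ (-α))) =
        TensorProduct.map LinearMap.id (S.constraint (S.C.τ (-α))) ∘ₗ
          onGhost (V := V) (S.C.c α) := TensorProduct.ext' fun ψ v => rfl
    exact LinearMap.congr_fun h Φ
  rw [S.shifted_repOp, S.C.ghost_rootBasis hab]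
  refine (congrArg (fun v => inner ℂ φ (S.coeff _ v)) (h1 Φ)).trans ?_
  rw [coeff_map, inner_constraint_neg hS (hS.positive.isRoot α hα), hφ α hα, inner_zero_left,
    neg_zero]

lemma vacuum_tmul_mem [𝔱.IsCartanSubalgebra]
    (hcompact : ∀ x : 𝔤, x ≠ 0 → killingForm ℝ 𝔤 x x < 0)
    (hS : S.IsRegularDominant) {φ : V} (hφ : φ ∈ S.borelInvariants) :
    S.C.vacuum S.P ⊗ₜ φ ∈ S.harmonicBidegree 0 0 := by
  have hab := lie_cartan_cartan hcompact 𝔱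
  obtain ⟨h1, h2⟩ := mem_borelInvariants.mp hφ
  have hvac := isVacuum_tmul hS.positive hab φ
  have hD := (D_vacuum_tmul_eq_zero_iff hS hab h2).mpr h1
  have hCrel : S.C.vacuum S.P ⊗ₜ φ ∈ S.Crel := by
    refine ⟨(Submodule.mem_iInf _).mpr fun h => ?_, (Submodule.mem_iInf _).mpr fun i =>
      hvac.incl_eq_zero (S.C.cartanVec i)⟩
    rw [LinearMap.mem_ker, totalCartan_vacuum_tmul hS hab, h2, tmul_zero]
  refine ⟨⟨⟨⟨?_, hCrel⟩, 0, 0, ⟨zero_mem _, fun Φ _ => ?_⟩, ⟨zero_mem _, fun Φ _ => ?_⟩, by simp⟩,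
    Module.End.mem_eigenspace_iff.mpr ?_⟩, Module.End.mem_eigenspace_iff.mpr ?_⟩
  · exact (congrArg S.D hD).trans (map_zero _)
  · rw [pairing_vacuum_D hS hab h1]
    simp [pairing]
  · rw [hD]
    simp [pairing]
  · rw [Nat.cast_zero, zero_smul, ChevalleyBasis.ghBar, onGhost_sum, LinearMap.sum_apply]
    refine Finset.sum_eq_zero fun α hα => ?_
    rw [onGhost_mul, Module.End.mul_apply, ← S.C.antighost_rootBasis hab,
      hvac.antighost_eq_zero α hα, map_zero]
  · rw [Nat.cast_zero, zero_smul, ChevalleyBasis.gh, onGhost_sum, LinearMap.sum_apply]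
    refine Finset.sum_eq_zero fun α hα => ?_
    rw [onGhost_mul, Module.End.mul_apply, ← S.C.ghost_rootBasis hab,
      hvac.ghost_eq_zero α hα, map_zero]

lemma exists_of_mem_harmonicBidegree [𝔱.IsCartanSubalgebra]
    (hcompact : ∀ x : 𝔤, x ≠ 0 → killingForm ℝ 𝔤 x x < 0) (hS : S.IsRegularDominant)
    {Ψ : Cochain 𝔤 V} (hΨ : Ψ ∈ S.harmonicBidegree 0 0) :
    ∃ φ ∈ S.borelInvariants, S.C.vacuum S.P ⊗ₜ φ = Ψ := by
  have hab := lie_cartan_cartan hcompact 𝔱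
  obtain ⟨⟨hH, hbar⟩, hgh⟩ := hΨ
  have hbar := Module.End.mem_eigenspace_iff.mp hbar
  have hgh := Module.End.mem_eigenspace_iff.mp hgh
  rw [Nat.cast_zero, zero_smul] at hbar hgh
  obtain ⟨hT, hb⟩ := hH.1.2
  have hΨ := eq_vacuum_tmul hS.positive (fun i => (Submodule.mem_iInf _).mp hb i) hbar hgh
  set φ := S.coeff (S.C.vacuumLabels S.P) Ψ
  have h2 : ∀ h : cartan 𝔱, S.constraint (h : ℂ ⊗[ℝ] 𝔤) φ = 0 := fun h => by
    have hTh : S.totalCartan h Ψ = 0 := (Submodule.mem_iInf _).mp hT h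
    rw [hΨ, totalCartan_vacuum_tmul hS hab] at hTh
    rw [← S.coeff_vacuum_tmul (S.constraint (h : ℂ ⊗[ℝ] 𝔤) φ), hTh, map_zero]
  have hD := D_eq_zero_of_harmonic hcompact hS hH
  rw [hΨ, D_vacuum_tmul_eq_zero_iff hS hab h2] at hD
  exact ⟨φ, mem_borelInvariants.mpr ⟨hD, h2⟩, hΨ.symm⟩

end System

end Harmonic

end AnomalousLie

theorem proposition2p3 {𝔤 : Type*} [LieRing 𝔤] [LieAlgebra ℝ 𝔤] [Module.Finite ℝ 𝔤]
    [LieAlgebra.IsSimple ℝ 𝔤] (hcompact : ∀ x : 𝔤, x ≠ 0 → killingForm ℝ 𝔤 x x < 0)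
    (𝔱 : LieSubalgebra ℝ 𝔤) [𝔱.IsCartanSubalgebra] {l : ℕ}
    {V : Type*} [NormedAddCommGroup V] [InnerProductSpace ℂ V]
    (S : AnomalousLie.System 𝔱 l V) (hS : S.IsRegularDominant) :
    (∀ r : ℤ, 0 < r → Subsingleton (S.Hrel r)) ∧
      ∃ e : S.borelInvariants ≃ₗ[ℂ] S.harmonicBidegree 0 0,
        ∀ φ : S.borelInvariants,
          (e φ : AnomalousLie.Cochain 𝔤 V) = TensorProduct.tmul ℂ (S.C.vacuum S.P) (φ : V) := by
  constructor
  · intro r hr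
    exact Submodule.Quotient.subsingleton_iff.mpr
      (Submodule.comap_subtype_eq_top.mpr (S.Zrel_le_Brel hcompact hS hr))
  · let f : S.borelInvariants →ₗ[ℂ] S.harmonicBidegree 0 0 :=
      (TensorProduct.mk ℂ (AnomalousLie.Ghost 𝔤) V (S.C.vacuum S.P)).restrict
        fun φ hφ => AnomalousLie.System.vacuum_tmul_mem hcompact hS hφ
    refine ⟨LinearEquiv.ofBijective f ⟨fun φ φ' h => Subtype.ext ?_, fun Ψ => ?_⟩, fun φ => rfl⟩
    · have h' : TensorProduct.tmul ℂ (S.C.vacuum S.P) (φ : V)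
          = TensorProduct.tmul ℂ (S.C.vacuum S.P) (φ' : V) := congrArg Subtype.val h
      rw [← S.coeff_vacuum_tmul (φ : V), h', S.coeff_vacuum_tmul]
    · obtain ⟨φ, hφ, h⟩ := AnomalousLie.System.exists_of_mem_harmonicBidegree hcompact hS Ψ.2
      exact ⟨⟨φ, hφ⟩, Subtype.ext h⟩
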